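/- Let $K$ be an algebraically closed field of characteristic $0$. A variety over $K$ is an integral separated scheme of finite type over $K$; a subvariety of a variety is an irreducible closed subset with its reduced structure. A \emph{distinguished category} over $K$ is a category $\mathfrak C$ with a functor $\mathcal F$ to the category of varieties over $K$ satisfying the following axioms. We call the objects of $\mathfrak C$ distinguished varieties and its morphisms distinguished morphisms, and we often write $X$, $\phi$ for $\mathcal F(X)$, $\mathcal F(\phi)$. (A1) For all objects $X,Y$ there are an object $Z$ and morphisms $\pi_X:Z\to X$, $\pi_Y:Z\to Y$ such that the induced morphism $\mathcal F(Z)\to\mathcal F(X)\times_K\mathcal F(Y)$ is an isomorphism and such that for all morphisms $\phi:W\to X$, $\psi:W\to Y$ there is a morphism $\chi:W\to Z$ with $\pi_X\circ\chi=\phi$ and $\pi_Y\circ\chi=\psi$. We write $X\times Y$ for such a $Z$. (A2) For all morphisms $\phi:X\to Z$, $\psi:Y\to Z$ there are finitely many (possibly zero) morphisms $\phi_i:X_i\to X\times Y$, $1\le i\le n$, with $\bigcup_{i}\mathcal F(\phi_i)(\mathcal F(X_i))=(\mathcal F(X)\times_{\mathcal F(Z)}\mathcal F(Y))_{\mathrm{red}}\subset\mathcal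 F(X)\times_K\mathcal F(Y)$. (A3) $\mathfrak C$ has a final object, and $\mathcal F$ maps it to $\operatorname{Spec}K$. (A4) For every morphism $\phi:X\to Y$ the image of $\mathcal F(\phi)$ is closed, and there are morphisms $\phi_1:W\to X$, $\phi_2:W\to Z$, $\phi_3:Z\to Y$ with $\phi\circ\phi_1=\phi_3\circ\phi_2$ such that $\mathcal F(\phi_1)$ is finite and surjective, $\mathcal F(\phi_3)$ has finite fibers, all non-empty fibers of $\mathcal F(\phi_2)$ are irreducible, and $w\mapsto\dim_w\mathcal F(\phi_2)^{-1}(\mathcal F(\phi_2)(w))$ is constant on $\mathcal F(W)$. A subvariety of a distinguished variety $X$ is \emph{special} if it is the image of a distinguished morphism to $X$; it is \emph{weakly special} if it is an irreducible component of $\phi(\psi^{-1}(y))$ for some distinguished morphisms $\phi:Z\to X$, $\psi:Z\to Y$ and some $y\in Y(K)$. For a subvariety $V$ of $X$, there are a smallest special subvariety $\langle V\rangle$ and a smallest weakly special subvariety $\langle V\rangle_{\mathrm{ws}}$ of $X$ containing $V$. Set $\delta(V)=\dim\langle V\rangle-\dim V$ (the \emph{defect}) and $\delta_{\mathrm{ws}}(V)=\dim\langle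 V\rangle_{\mathrm{ws}}-\dim V$. A subvariety $W\subset V$ is \emph{optimal} (respectively \emph{weakly optimal}) for $V$ in $X$ if $\delta(U)>\delta(W)$ (respectively $\delta_{\mathrm{ws}}(U)>\delta_{\mathrm{ws}}(W)$) for every subvariety $U$ with $W\subsetneq U\subset V$. For a subvariety $V$ of a distinguished variety $X$, call a finite set $T$ of pairs $(\phi,\psi)$ of distinguished morphisms $\phi:Y_\phi\to X$, $\psi:Y_\phi\to Z_\psi$ a \emph{weak finiteness set} for $V$ if for every subvariety $W\subset V$ weakly optimal for $V$ in $X$ there are $(\phi,\psi)\in T$ and $z\in Z_\psi(K)$ such that $\phi$ has finite fibers and $\langle W\rangle_{\mathrm{ws}}$ is an irreducible component of $\phi(\psi^{-1}(z))$. Axiom (A5) says that every subvariety of every distinguished variety has a weak finiteness set. For integers $m,d\ge0$ and a distinguished variety $X$, we say that $\mathrm{ZP}(X,m,d)$ holds if for every subvariety $V$ of $X$ with $\dim V\le m$ there are at most finitely many subvarieties $W$ that are optimal for $V$ in $X$ and satisfy $\delta(W)\le d$. \textbf{Theorem.} Let $m,d\ge0$ be integers and let $\mathfrak C$ be a distinguished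 category over $K$ that satisfies (A5). Let $X$ be a distinguished variety and let $\mathcal S$ be a class of distinguished varieties such that $X\in\mathcal S$ and, for every $X'\in\mathcal S$, every subvariety of $X'$ has a weak finiteness set all of whose pairs $(\phi,\psi)$ satisfy $Y_\phi,Z_\psi\in\mathcal S$. Suppose that for every $X'\in\mathcal S$ and every subvariety $V$ of $X'$ with $\dim V\le m$ there are at most finitely many closed points $x\in V$ such that $\{x\}$ is optimal for $V$ in $X'$ and $\delta(\{x\})\le d$. Then $\mathrm{ZP}(X,m,d)$ holds. -/

import Mathlib

open CategoryTheory CategoryTheory.Limits AlgebraicGeometry TopologicalSpace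

universe u v w

namespace ZilberPink

/-! ### Varieties -/

/-- Algebraic varieties over `K`: integral separated schemes of finite type over `K`. -/
def IsVariety (K : Type u) [Field K] : ObjectProperty (Over (Spec (.of K))) := fun X =>
  IsIntegral X.left ∧ IsSeparated X.hom ∧ LocallyOfFiniteType X.hom ∧ QuasiCompact X.hom

/-- The category of algebraic varieties over `K` (morphisms are morphisms of `K`-schemes). -/
abbrev Variety (K : Type u) [Field K] := (IsVariety K).FullSubcategory

/-- `B` is an irreducible component of the subset `A` of a topological space:
a maximal irreducible subset of `A`. -/
def IsComponentOf {T : Type u} [TopologicalSpace T] (B A : Set T) : Prop :=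
  Maximal (fun s : Set T => IsIrreducible s ∧ s ⊆ A) B

/-- The local dimension `dim_x A` of the subspace `A` at a point `x ∈ A`: the least dimension of an
open neighbourhood of `x` in `A`. -/
noncomputable def localDim {T : Type u} [TopologicalSpace T] (A : Set T) (x : T) : WithBot ℕ∞ :=
  ⨅ U : {U : Set T // IsOpen U ∧ x ∈ U}, topologicalKrullDim ↥(A ∩ U.1)

section Functor

variable {K : Type u} [Field K] {C : Type v} [Category.{w} C] (F : C ⥤ Variety K)

/-- The variety `F(X)`, as a scheme. -/
noncomputable abbrev var (X : C) : Scheme.{u} := (F.obj X).obj.left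

/-- The structure morphism `F(X) ⟶ Spec K`. -/
noncomputable abbrev str (X : C) : var F X ⟶ Spec (.of K) := (F.obj X).obj.hom

/-- The morphism of varieties `F(f)`. -/
noncomputable abbrev mor {X Y : C} (f : X ⟶ Y) : var F X ⟶ var F Y := (F.map f).hom.left

lemma mor_str {X Y : C} (f : X ⟶ Y) : mor F f ≫ str F Y = str F X :=
  Over.w (F.map f).hom

/-- The morphism `F(W) ⟶ F(X) ×_K F(Y)` induced by `F(a)` and `F(b)`. -/
noncomputable def toProd {W X Y : C} (a : W ⟶ X) (b : W ⟶ Y) :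
    var F W ⟶ pullback (str F X) (str F Y) :=
  pullback.lift (mor F a) (mor F b) (by rw [mor_str, mor_str])

/-- The inclusion `F(X) ×_{F(Z)} F(Y) ⟶ F(X) ×_K F(Y)`. -/
noncomputable def fiberProdIncl {X Y Z : C} (φ : X ⟶ Z) (ψ : Y ⟶ Z) :
    pullback (mor F φ) (mor F ψ) ⟶ pullback (str F X) (str F Y) :=
  pullback.lift (pullback.fst _ _) (pullback.snd _ _) (by
    rw [← mor_str F φ, ← mor_str F ψ, pullback.condition_assoc])

/-- `P`, with `π₁ : P ⟶ X` and `π₂ : P ⟶ Y`, is a direct product of `X` and `Y` compatible with the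
functor `F`. The morphism `χ` is not required to be unique. -/
structure IsDirectProduct {P X Y : C} (π₁ : P ⟶ X) (π₂ : P ⟶ Y) : Prop where
  isIso : IsIso (toProd F π₁ π₂)
  lift : ∀ (W : C) (φ : W ⟶ X) (ψ : W ⟶ Y), ∃ χ : W ⟶ P, χ ≫ π₁ = φ ∧ χ ≫ π₂ = ψ

/-- The category `C`, together with the functor `F` to varieties over `K`, is a distinguished
category. -/
class IsDistinguished : Prop where
  /-- Direct products. -/
  direct_products : ∀ X Y : C, ∃ (P : C) (π₁ : P ⟶ X) (π₂ : P ⟶ Y), IsDirectProduct F π₁ π₂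
  /-- Fibered products: the (reduced) closed subset `F(X) ×_{F(Z)} F(Y)` of
  `F(P) ≅ F(X) ×_K F(Y)` is a finite union of images of morphisms of `C`. -/
  fibered_products : ∀ {X Y Z : C} (φ : X ⟶ Z) (ψ : Y ⟶ Z) {P : C} (π₁ : P ⟶ X) (π₂ : P ⟶ Y),
    IsDirectProduct F π₁ π₂ →
      ∃ (n : ℕ) (D : Fin n → C) (χ : ∀ i, D i ⟶ P),
        ⋃ i, Set.range (mor F (χ i) ≫ toProd F π₁ π₂) = Set.range (fiberProdIncl F φ ψ)
  /-- Final object. -/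
  final_object : ∃ T : C, Nonempty (IsTerminal T) ∧ IsIso (str F T)
  /-- Fiber dimension: images are closed. -/
  isClosed_range : ∀ {X Y : C} (φ : X ⟶ Y), IsClosed (Set.range (mor F φ))
  /-- Fiber dimension: factorization. -/
  fiber_dimension : ∀ {X Y : C} (φ : X ⟶ Y),
    ∃ (W Z : C) (φ₁ : W ⟶ X) (φ₂ : W ⟶ Z) (φ₃ : Z ⟶ Y),
      φ₁ ≫ φ = φ₂ ≫ φ₃ ∧
      IsFinite (mor F φ₁) ∧ Function.Surjective (mor F φ₁) ∧
      (∀ y : var F Y, (mor F φ₃ ⁻¹' {y}).Finite) ∧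
      (∀ z ∈ Set.range (mor F φ₂), IsIrreducible (mor F φ₂ ⁻¹' {z})) ∧
      ∃ n : WithBot ℕ∞, ∀ x : var F W, localDim (mor F φ₂ ⁻¹' {mor F φ₂ x}) x = n

/-- Subvarieties of `F(X)`: closed integral subschemes, each of which is given by its underlying
irreducible closed subset (with the reduced structure). -/
abbrev Subvariety (X : C) := IrreducibleCloseds (var F X)

variable {F}

/-- A subvariety is special if it is the image of a distinguished morphism. -/
def IsSpecial {X : C} (S : Subvariety F X) : Prop :=
  ∃ (Y : C) (φ : Y ⟶ X), (S : Set (var F X)) = Set.range (mor F φ)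

/-- A subvariety is weakly special if it is an irreducible component of `φ(ψ⁻¹(y))` for
distinguished morphisms `φ`, `ψ` and a `K`-rational, i.e. closed, point `y`. -/
def IsWeaklySpecial {X : C} (S : Subvariety F X) : Prop :=
  ∃ (Z Y : C) (φ : Z ⟶ X) (ψ : Z ⟶ Y) (y : var F Y), IsClosed {y} ∧
    IsComponentOf (S : Set (var F X)) (mor F φ '' (mor F ψ ⁻¹' {y}))

end Functor

/-! ### Existence of smallest (weakly) special subvarieties, finiteness of dimension -/

section Topology

variable {T : Type u} [TopologicalSpace T]

lemma IsComponentOf.isClosed {A B : Set T} (hA : IsClosed A) (h : IsComponentOf B A) :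
    IsClosed B := by
  have h1 : closure B ⊆ B :=
    h.le_of_ge ⟨h.prop.1.closure, hA.closure_subset_iff.2 h.prop.2⟩ subset_closure
  exact isClosed_of_closure_subset h1

lemma exists_isComponentOf {A V : Set T} (hV : IsIrreducible V) (hVA : V ⊆ A) :
    ∃ B, IsComponentOf B A ∧ V ⊆ B := by
  have hchain : ∀ c ⊆ {t : Set T | IsIrreducible t ∧ t ⊆ A}, IsChain (· ⊆ ·) c → c.Nonempty →
      ∃ ub ∈ {t : Set T | IsIrreducible t ∧ t ⊆ A}, ∀ s ∈ c, s ⊆ ub := by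
    intro c hc hcc hne
    refine ⟨⋃₀ c, ⟨⟨?_, ?_⟩, Set.sUnion_subset fun s hs => (hc hs).2⟩,
      fun _ hs => Set.subset_sUnion_of_mem hs⟩
    · obtain ⟨s, hs⟩ := hne
      exact (hc hs).1.nonempty.mono (Set.subset_sUnion_of_mem hs)
    · rintro u v hu hv ⟨y, ⟨p, hp, hyp⟩, hyu⟩ ⟨x, ⟨q, hq, hxq⟩, hxv⟩
      obtain hpq | hqp := hcc.total hp hq
      · obtain ⟨z, hz, hz'⟩ := (hc hq).1.2 u v hu hv ⟨y, hpq hyp, hyu⟩ ⟨x, hxq, hxv⟩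
        exact ⟨z, ⟨q, hq, hz⟩, hz'⟩
      · obtain ⟨z, hz, hz'⟩ := (hc hp).1.2 u v hu hv ⟨y, hyp, hyu⟩ ⟨x, hqp hxq, hxv⟩
        exact ⟨z, ⟨p, hp, hz⟩, hz'⟩
  obtain ⟨m, hVm, hm⟩ := zorn_subset_nonempty _ hchain V ⟨hV, hVA⟩
  exact ⟨m, hm, hVm⟩

lemma exists_subset_of_subset_iUnion {n : ℕ} {V : Set T} (hV : IsIrreducible V)
    (A : Fin n → Set T) (hA : ∀ i, IsClosed (A i)) (h : V ⊆ ⋃ i, A i) : ∃ i, V ⊆ A i := by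
  classical
  obtain ⟨z, hz, hVz⟩ := isIrreducible_iff_sUnion_isClosed.1 hV (Finset.univ.image A)
    (by simpa using hA) (by simpa using h)
  obtain ⟨i, -, rfl⟩ := Finset.mem_image.1 hz
  exact ⟨i, hVz⟩

/-- In a Noetherian space, a filtered family of irreducible closed sets has a least element. -/
lemma exists_isLeast_irreducibleCloseds [NoetherianSpace T] (A : Set (IrreducibleCloseds T))
    (hne : A.Nonempty) (h : ∀ S ∈ A, ∀ S' ∈ A, ∃ R ∈ A, R ≤ S ∧ R ≤ S') : ∃ S, IsLeast A S := by
  have hmono : StrictMono (fun S : IrreducibleCloseds T => (⟨S, S.isClosed⟩ : Closeds T)) :=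
    fun _ _ h => h
  have : WellFoundedLT (IrreducibleCloseds T) := hmono.wellFoundedLT
  obtain ⟨M, hM, hmin⟩ := WellFounded.has_min (wellFounded_lt (α := IrreducibleCloseds T)) A hne
  refine ⟨M, hM, fun S hS => ?_⟩
  obtain ⟨R, hR, hRM, hRS⟩ := h M hM S hS
  obtain rfl : R = M := eq_of_le_of_not_lt hRM (hmin R hR)
  exact hRS

end Topology

section

variable {K : Type u} [Field K] {C : Type v} [Category.{w} C] (F : C ⥤ Variety K)

instance instIsIntegralVar (X : C) : IsIntegral (var F X) := (F.obj X).property.1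
instance instLocallyOfFiniteTypeStr (X : C) : LocallyOfFiniteType (str F X) := (F.obj X).property.2.2.1
instance instQuasiCompactStr (X : C) : QuasiCompact (str F X) := (F.obj X).property.2.2.2

instance instNoetherianSpaceVar (X : C) : NoetherianSpace (var F X) := by
  have : IsLocallyNoetherian (var F X) := LocallyOfFiniteType.isLocallyNoetherian (str F X)
  have : CompactSpace (var F X) := QuasiCompact.compactSpace_of_compactSpace (str F X)
  have : IsNoetherian (var F X) := {}
  infer_instance

lemma mor_id (X : C) : mor F (𝟙 X) = 𝟙 _ := by simp [mor]

lemma mor_comp {X Y Z : C} (f : X ⟶ Y) (g : Y ⟶ Z) : mor F (f ≫ g) = mor F f ≫ mor F g := by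
  simp [mor]

lemma mor_comp_apply {X Y Z : C} (f : X ⟶ Y) (g : Y ⟶ Z) (x : var F X) :
    mor F (f ≫ g) x = mor F g (mor F f x) := by
  rw [mor_comp, Scheme.Hom.comp_apply]

lemma comp_toProd {V W X Y : C} (c : V ⟶ W) (a : W ⟶ X) (b : W ⟶ Y) :
    mor F c ≫ toProd F a b = toProd F (c ≫ a) (c ≫ b) := by
  apply pullback.hom_ext
  · rw [Category.assoc, toProd, toProd, pullback.lift_fst, pullback.lift_fst, mor_comp]
  · rw [Category.assoc, toProd, toProd, pullback.lift_snd, pullback.lift_snd, mor_comp]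

lemma fst_toProd {W X Y : C} (a : W ⟶ X) (b : W ⟶ Y) (x : var F W) :
    pullback.fst (str F X) (str F Y) (toProd F a b x) = mor F a x := by
  rw [← Scheme.Hom.comp_apply, toProd, pullback.lift_fst]

lemma snd_toProd {W X Y : C} (a : W ⟶ X) (b : W ⟶ Y) (x : var F W) :
    pullback.snd (str F X) (str F Y) (toProd F a b x) = mor F b x := by
  rw [← Scheme.Hom.comp_apply, toProd, pullback.lift_snd]

/-- Over a `K`-rational point of `Y`, the product `Y ×_K X` is a copy of `X`. -/
lemma exists_section [IsAlgClosed K] {Y X : C} (y : var F Y) (hy : IsClosed {y}) :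
    ∃ q : var F X ⟶ pullback (str F Y) (str F X),
      (∀ x, pullback.fst (str F Y) (str F X) (q x) = y) ∧
      (∀ x, pullback.snd (str F Y) (str F X) (q x) = x) ∧
      ∀ p, pullback.fst (str F Y) (str F X) p = y → q (pullback.snd (str F Y) (str F X) p) = p := by
  let s : Spec (.of K) ⟶ var F Y := pointOfClosedPoint (str F Y) y hy
  have hs : s ≫ str F Y = 𝟙 _ := pointOfClosedPoint_comp _ _ _
  have hsy : ∀ a, s a = y := fun a => pointOfClosedPoint_apply _ _ _ _
  let q : var F X ⟶ pullback (str F Y) (str F X) :=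
    pullback.lift (str F X ≫ s) (𝟙 _) (by rw [Category.assoc, hs]; simp)
  have hq1 : q ≫ pullback.fst _ _ = str F X ≫ s := pullback.lift_fst _ _ _
  have hq2 : q ≫ pullback.snd _ _ = 𝟙 _ := pullback.lift_snd _ _ _
  refine ⟨q, fun x => ?_, fun x => ?_, fun p hp => ?_⟩
  · rw [← Scheme.Hom.comp_apply, hq1, Scheme.Hom.comp_apply, hsy]
  · rw [← Scheme.Hom.comp_apply, hq2]
    rfl
  · have hp' : p ∈ Set.range (pullback.fst (pullback.fst (str F Y) (str F X)) s) := by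
      rw [Scheme.Pullback.range_fst]
      exact ⟨(IsLocalRing.closedPoint K : PrimeSpectrum K), (hsy _).trans hp.symm⟩
    obtain ⟨t, rfl⟩ := hp'
    have key : pullback.fst (pullback.fst (str F Y) (str F X)) s ≫
        pullback.snd (str F Y) (str F X) ≫ q =
          pullback.fst (pullback.fst (str F Y) (str F X)) s := by
      apply pullback.hom_ext
      · rw [Category.assoc, Category.assoc, hq1, ← pullback.condition_assoc, pullback.condition_assoc,
          reassoc_of% hs, pullback.condition]
      · rw [Category.assoc, Category.assoc, hq2, Category.comp_id]
    rw [← Scheme.Hom.comp_apply, ← Scheme.Hom.comp_apply, key]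

lemma ringKrullDim_le_of_finiteType (A : Type u) [CommRing A] [Algebra K A]
    [Algebra.FiniteType K A] : ∃ N : ℕ, ringKrullDim A ≤ N := by
  obtain ⟨n, f, hf⟩ := Algebra.FiniteType.iff_quotient_mvPolynomial''.1
    (inferInstance : Algebra.FiniteType K A)
  refine ⟨n, (ringKrullDim_le_of_surjective f.toRingHom hf).trans (le_of_eq ?_)⟩
  rw [MvPolynomial.ringKrullDim_of_isNoetherianRing, ringKrullDim_eq_zero_of_field]
  simp

lemma topologicalKrullDim_le_of_affine {R : CommRingCat.{u}} (g : Spec R ⟶ Spec (.of K))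
    [LocallyOfFiniteType g] : ∃ N : ℕ, topologicalKrullDim (Spec R) ≤ N := by
  have hft : LocallyOfFiniteType g := inferInstance
  obtain ⟨f, rfl⟩ := Spec.map_surjective g
  rw [HasRingHomProperty.Spec_iff (P := @LocallyOfFiniteType)] at hft
  algebraize [f.hom]
  obtain ⟨N, hN⟩ := ringKrullDim_le_of_finiteType (K := K) R
  exact ⟨N, (PrimeSpectrum.topologicalKrullDim_eq_ringKrullDim R).trans_le hN⟩

lemma exists_topologicalKrullDim_le (X : C) : ∃ N : ℕ, topologicalKrullDim (var F X) ≤ N := by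
  have : CompactSpace (var F X) := QuasiCompact.compactSpace_of_compactSpace (str F X)
  let 𝒰 := (var F X).affineCover
  have hlf : ∀ i, LocallyOfFiniteType (𝒰.f i ≫ str F X) := fun i => inferInstance
  have hdim : ∀ i, ∃ N : ℕ, topologicalKrullDim (𝒰.X i) ≤ N := fun i =>
    @topologicalKrullDim_le_of_affine K _ _ (𝒰.f i ≫ str F X) (hlf i)
  choose N hN using hdim
  obtain ⟨t, ht⟩ := isCompact_univ.elim_finite_subcover (fun i => Set.range (𝒰.f i))
    (fun i => (𝒰.f i).isOpenEmbedding.isOpen_range)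
    (fun x _ => Set.mem_iUnion.2 ⟨𝒰.idx x, 𝒰.covers x⟩)
  refine ⟨t.sup N, ?_⟩
  rw [topologicalKrullDim, Order.krullDim_eq_iSup_coheight]
  refine iSup_le fun Z => ?_
  obtain ⟨x, hx⟩ := Z.isIrreducible.nonempty
  obtain ⟨i, hi, u, rfl⟩ := Set.mem_iUnion₂.1 (ht (Set.mem_univ x))
  let e := IrreducibleCloseds.orderIsoOfIsOpenEmbedding _ (𝒰.f i).isOpenEmbedding
  have h2 : IrreducibleCloseds.map (𝒰.f i) (𝒰.f i).continuous (e.symm ⟨Z, u, hx⟩) = Z :=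
    congrArg Subtype.val (e.apply_symm_apply ⟨Z, u, hx⟩)
  rw [← h2, (𝒰.f i).isOpenEmbedding.coheight_map]
  refine (Order.coheight_le_krullDim _).trans ((hN i).trans ?_)
  exact_mod_cast Finset.le_sup hi

variable {F}

lemma isSpecial_top (X : C) :
    IsSpecial (⟨Set.univ, IrreducibleSpace.isIrreducible_univ _, isClosed_univ⟩ :
      Subvariety F X) :=
  ⟨X, 𝟙 X, by rw [mor_id]; exact (Set.range_id).symm⟩

variable [IsDistinguished F]

lemma isClosed_range_toProd {W X Y : C} (a : W ⟶ X) (b : W ⟶ Y) :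
    IsClosed (Set.range (toProd F a b)) := by
  obtain ⟨P, π₁, π₂, hP⟩ := IsDistinguished.direct_products (F := F) X Y
  obtain ⟨χ, rfl, rfl⟩ := hP.lift W a b
  have := hP.isIso
  rw [← comp_toProd, Scheme.Hom.comp_base, TopCat.coe_comp, Set.range_comp]
  exact (toProd F π₁ π₂).homeomorph.isClosedMap _ (IsDistinguished.isClosed_range χ)

/-- Images of fibers over `K`-rational points are closed. -/
lemma isClosed_image_fiber [IsAlgClosed K] {Z X Y : C} (φ : Z ⟶ X) (ψ : Z ⟶ Y) (y : var F Y)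
    (hy : IsClosed {y}) : IsClosed (mor F φ '' (mor F ψ ⁻¹' {y})) := by
  obtain ⟨q, hq, hq₂, hq'⟩ := exists_section F (X := X) y hy
  convert (isClosed_range_toProd (F := F) ψ φ).preimage q.continuous
  ext x
  constructor
  · rintro ⟨u, hu, rfl⟩
    refine ⟨u, ?_⟩
    rw [← hq' (toProd F ψ φ u) (by rw [fst_toProd]; exact hu), snd_toProd]
  · rintro ⟨u, hu⟩
    refine ⟨u, ?_, ?_⟩
    · rw [Set.mem_preimage, Set.mem_singleton_iff, ← fst_toProd F ψ φ, hu, hq]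
    · rw [← snd_toProd F ψ φ, hu, hq₂]

/-- The intersection of two sets of the form `φ(ψ⁻¹(B))` is a finite union of such sets. -/
lemma exists_inter_eq_iUnion {X Z Z' : C} (φ : Z ⟶ X) (φ' : Z' ⟶ X) :
    ∃ (n : ℕ) (D : Fin n → C) (a : ∀ i, D i ⟶ Z) (b : ∀ i, D i ⟶ Z'),
      (∀ i u, mor F φ (mor F (a i) u) = mor F φ' (mor F (b i) u)) ∧
      ∀ z z', mor F φ z = mor F φ' z' → ∃ i u, mor F (a i) u = z ∧ mor F (b i) u = z' := by
  obtain ⟨P, π₁, π₂, hP⟩ := IsDistinguished.direct_products (F := F) Z Z'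
  obtain ⟨n, D, χ, h⟩ := IsDistinguished.fibered_products φ φ' π₁ π₂ hP
  have e1 : ∀ p, pullback.fst (str F Z) (str F Z') (fiberProdIncl F φ φ' p) =
      pullback.fst (mor F φ) (mor F φ') p := fun p => by
    rw [← Scheme.Hom.comp_apply, fiberProdIncl, pullback.lift_fst]
  have e2 : ∀ p, pullback.snd (str F Z) (str F Z') (fiberProdIncl F φ φ' p) =
      pullback.snd (mor F φ) (mor F φ') p := fun p => by
    rw [← Scheme.Hom.comp_apply, fiberProdIncl, pullback.lift_snd]
  refine ⟨n, D, fun i => χ i ≫ π₁, fun i => χ i ≫ π₂, fun i u => ?_, fun z z' hz => ?_⟩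
  · have hu : toProd F (χ i ≫ π₁) (χ i ≫ π₂) u ∈ Set.range (fiberProdIncl F φ φ') := by
      rw [← h, ← comp_toProd]
      exact Set.mem_iUnion.2 ⟨i, u, rfl⟩
    obtain ⟨p, hp⟩ := hu
    rw [← fst_toProd F (χ i ≫ π₁) (χ i ≫ π₂), ← snd_toProd F (χ i ≫ π₁) (χ i ≫ π₂), ← hp, e1, e2,
      ← Scheme.Hom.comp_apply, ← Scheme.Hom.comp_apply, pullback.condition]
  · obtain ⟨p, hp1, hp2⟩ := Scheme.Pullback.exists_preimage_pullback z z' hz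
    have hp : fiberProdIncl F φ φ' p ∈ ⋃ i, Set.range (mor F (χ i) ≫ toProd F π₁ π₂) := by
      rw [h]; exact ⟨p, rfl⟩
    obtain ⟨i, u, hu⟩ := Set.mem_iUnion.1 hp
    rw [comp_toProd] at hu
    refine ⟨i, u, ?_, ?_⟩
    · rw [← fst_toProd F (χ i ≫ π₁) (χ i ≫ π₂), hu, e1, hp1]
    · rw [← snd_toProd F (χ i ≫ π₁) (χ i ≫ π₂), hu, e2, hp2]

lemma exists_isSpecial_le_inf {X : C} {V S S' : Subvariety F X} (hS : IsSpecial S)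
    (hS' : IsSpecial S') (hV : V ≤ S) (hV' : V ≤ S') :
    ∃ R : Subvariety F X, (IsSpecial R ∧ V ≤ R) ∧ R ≤ S ∧ R ≤ S' := by
  obtain ⟨Z, φ, hφ⟩ := hS
  obtain ⟨Z', φ', hφ'⟩ := hS'
  obtain ⟨n, D, a, b, hab, h⟩ := exists_inter_eq_iUnion (F := F) φ φ'
  obtain ⟨i, hi⟩ := exists_subset_of_subset_iUnion V.isIrreducible
    (fun i => Set.range (mor F (a i ≫ φ))) (fun i => IsDistinguished.isClosed_range _) (by
      intro x hx
      obtain ⟨z, rfl⟩ := hφ.subset (hV hx)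
      obtain ⟨z', hz'⟩ := hφ'.subset (hV' hx)
      obtain ⟨i, u, rfl, -⟩ := h z z' hz'.symm
      exact Set.mem_iUnion.2 ⟨i, u, mor_comp_apply F _ _ u⟩)
  refine ⟨⟨Set.range (mor F (a i ≫ φ)), ?_, IsDistinguished.isClosed_range _⟩,
    ⟨⟨D i, a i ≫ φ, rfl⟩, hi⟩, ?_, ?_⟩
  · rw [← Set.image_univ]
    exact (IrreducibleSpace.isIrreducible_univ _).image _ (mor F (a i ≫ φ)).continuous.continuousOn
  · rintro _ ⟨u, rfl⟩
    change _ ∈ (S : Set (var F X))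
    rw [hφ, mor_comp_apply]
    exact ⟨_, rfl⟩
  · rintro _ ⟨u, rfl⟩
    change _ ∈ (S' : Set (var F X))
    rw [hφ', mor_comp_apply, hab]
    exact ⟨_, rfl⟩

/-- A weakly special subvariety is of the form `φ(ψ⁻¹(y))`, not only a component of such a set. -/
lemma IsWeaklySpecial.exists_eq [IsAlgClosed K] {X : C} {S : Subvariety F X}
    (hS : IsWeaklySpecial S) :
    ∃ (Z Y : C) (φ : Z ⟶ X) (ψ : Z ⟶ Y) (y : var F Y), IsClosed {y} ∧
      (S : Set (var F X)) = mor F φ '' (mor F ψ ⁻¹' {y}) := by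
  obtain ⟨Z, Y, φ, ψ, y, hy, hS⟩ := hS
  obtain ⟨W, Y', φ₁, φ₂, φ₃, hcomm, -, hsurj, hfin, hirr, -⟩ :=
    IsDistinguished.fiber_dimension (F := F) ψ
  have : JacobsonSpace (var F Y') := LocallyOfFiniteType.jacobsonSpace (str F Y')
  have hcl : ∀ v, mor F φ₃ v = y → IsClosed {v} := by
    have h1 : IsClosed (mor F φ₃ ⁻¹' {y}) := hy.preimage (mor F φ₃).continuous
    have h2 : IsClosed (mor F φ₃ ⁻¹' {y} ∩ closedPoints (var F Y')) := by
      rw [← Set.biUnion_of_singleton (mor F φ₃ ⁻¹' {y} ∩ closedPoints (var F Y'))]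
      exact ((hfin y).subset Set.inter_subset_left).isClosed_biUnion fun v hv => hv.2
    have h3 := JacobsonSpace.closure_inter_closedPoints h1
    rw [h2.closure_eq] at h3
    exact fun v hv => (h3.superset hv).2
  have hcomm' : ∀ u, mor F ψ (mor F φ₁ u) = mor F φ₃ (mor F φ₂ u) := fun u => by
    rw [← mor_comp_apply, hcomm, mor_comp_apply]
  have hfin' : (mor F φ₃ ⁻¹' {y}).Finite := hfin y
  have key : ∃ v, mor F φ₃ v = y ∧
      (S : Set (var F X)) ⊆ mor F (φ₁ ≫ φ) '' (mor F φ₂ ⁻¹' {v}) := by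
    classical
    obtain ⟨A, hA, hSA⟩ := isIrreducible_iff_sUnion_isClosed.1 S.isIrreducible
      (hfin'.toFinset.image fun v => mor F (φ₁ ≫ φ) '' (mor F φ₂ ⁻¹' {v})) (by
        intro A hA
        obtain ⟨v, hv, rfl⟩ := Finset.mem_image.1 hA
        exact isClosed_image_fiber _ _ _ (hcl v (hfin'.mem_toFinset.1 hv))) (by
        intro x hx
        obtain ⟨z, hz, rfl⟩ := hS.prop.2 hx
        obtain ⟨u, rfl⟩ := hsurj z
        refine ⟨mor F (φ₁ ≫ φ) '' (mor F φ₂ ⁻¹' {mor F φ₂ u}),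
          Finset.mem_coe.2 (Finset.mem_image_of_mem _ (hfin'.mem_toFinset.2 ?_)),
          ⟨u, rfl, mor_comp_apply F _ _ u⟩⟩
        rw [Set.mem_preimage, ← hcomm']
        exact hz)
    obtain ⟨v, hv, rfl⟩ := Finset.mem_image.1 hA
    exact ⟨v, hfin'.mem_toFinset.1 hv, hSA⟩
  obtain ⟨v, hv, hSv⟩ := key
  refine ⟨W, Y', φ₁ ≫ φ, φ₂, v, hcl v hv, hSv.antisymm (hS.le_of_ge ⟨?_, ?_⟩ hSv)⟩
  · obtain ⟨x, hx⟩ := S.isIrreducible.nonempty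
    obtain ⟨u, hu, -⟩ := hSv hx
    exact (hirr v ⟨u, hu⟩).image _ (mor F (φ₁ ≫ φ)).continuous.continuousOn
  · rintro _ ⟨u, hu, rfl⟩
    refine ⟨mor F φ₁ u, ?_, (mor_comp_apply F _ _ u).symm⟩
    rw [Set.mem_preimage, hcomm', hu, hv]
    rfl

lemma exists_isWeaklySpecial_le_inf [IsAlgClosed K] {X : C} {V S S' : Subvariety F X}
    (hS : IsWeaklySpecial S) (hS' : IsWeaklySpecial S') (hV : V ≤ S) (hV' : V ≤ S') :
    ∃ R : Subvariety F X, (IsWeaklySpecial R ∧ V ≤ R) ∧ R ≤ S ∧ R ≤ S' := by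
  obtain ⟨Z, Y, φ, ψ, y, hy, hφ⟩ := hS.exists_eq
  obtain ⟨Z', Y', φ', ψ', y', hy', hφ'⟩ := hS'.exists_eq
  obtain ⟨n, D, a, b, hab, h⟩ := exists_inter_eq_iUnion (F := F) φ φ'
  obtain ⟨P, π₁, π₂, hP⟩ := IsDistinguished.direct_products (F := F) Y Y'
  choose χ hχ₁ hχ₂ using fun i => hP.lift (D i) (a i ≫ ψ) (b i ≫ ψ')
  have hχ₁' : ∀ i u, mor F π₁ (mor F (χ i) u) = mor F ψ (mor F (a i) u) := fun i u => by
    rw [← mor_comp_apply, hχ₁, mor_comp_apply]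
  have hχ₂' : ∀ i u, mor F π₂ (mor F (χ i) u) = mor F ψ' (mor F (b i) u) := fun i u => by
    rw [← mor_comp_apply, hχ₂, mor_comp_apply]
  have hV0 : ∀ x ∈ V, ∃ i u, mor F (a i ≫ φ) u = x ∧
      mor F π₁ (mor F (χ i) u) = y ∧ mor F π₂ (mor F (χ i) u) = y' := by
    intro x hx
    obtain ⟨z, hz, rfl⟩ := hφ.subset (hV hx)
    obtain ⟨z', hz', hzz'⟩ := hφ'.subset (hV' hx)
    obtain ⟨i, u, rfl, rfl⟩ := h z z' hzz'.symm
    exact ⟨i, u, mor_comp_apply F _ _ u, (hχ₁' i u).trans hz, (hχ₂' i u).trans hz'⟩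
  have hsub : ∀ r r' : var F P, mor F π₁ r = y → mor F π₁ r' = y → mor F π₂ r = y' →
      mor F π₂ r' = y' → r = r' := by
    intro r r' h1 h1' h2 h2'
    have := hP.isIso
    obtain ⟨q, -, -, hq⟩ := exists_section F (X := Y') y hy
    apply (toProd F π₁ π₂).homeomorph.injective
    change toProd F π₁ π₂ r = toProd F π₁ π₂ r'
    rw [← hq (toProd F π₁ π₂ r) (by rw [fst_toProd, h1]),
      ← hq (toProd F π₁ π₂ r') (by rw [fst_toProd, h1']), snd_toProd, snd_toProd, h2, h2']
  obtain ⟨x₀, hx₀⟩ := V.isIrreducible.nonempty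
  obtain ⟨i₀, u₀, -, hr₁, hr₂⟩ := hV0 x₀ hx₀
  generalize mor F (χ i₀) u₀ = r at hr₁ hr₂
  have hr : IsClosed {r} := by
    have : ({r} : Set (var F P)) = mor F π₁ ⁻¹' {y} ∩ mor F π₂ ⁻¹' {y'} := by
      ext r'
      constructor
      · rintro rfl
        exact ⟨hr₁, hr₂⟩
      · rintro ⟨h1, h2⟩
        exact hsub _ _ h1 hr₁ h2 hr₂
    rw [this]
    exact (hy.preimage (mor F π₁).continuous).inter (hy'.preimage (mor F π₂).continuous)
  have hA : ∀ i, IsClosed (mor F (a i ≫ φ) '' (mor F (χ i) ⁻¹' {r})) := fun i =>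
    isClosed_image_fiber _ _ _ hr
  obtain ⟨i, hi⟩ := exists_subset_of_subset_iUnion V.isIrreducible _ hA (by
    intro x hx
    obtain ⟨i, u, rfl, h1, h2⟩ := hV0 x hx
    exact Set.mem_iUnion.2 ⟨i, u, hsub _ _ h1 hr₁ h2 hr₂, rfl⟩)
  obtain ⟨B, hB, hVB⟩ := exists_isComponentOf V.isIrreducible hi
  refine ⟨⟨B, hB.prop.1, hB.isClosed (hA i)⟩, ⟨⟨D i, P, a i ≫ φ, χ i, r, hr, hB⟩, hVB⟩, ?_, ?_⟩
  · intro x hx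
    obtain ⟨u, hu, rfl⟩ := hB.prop.2 hx
    refine hφ.superset ⟨mor F (a i) u, ?_, (mor_comp_apply F _ _ u).symm⟩
    rw [Set.mem_preimage, ← hχ₁', hu, hr₁]
    rfl
  · intro x hx
    obtain ⟨u, hu, rfl⟩ := hB.prop.2 hx
    refine hφ'.superset ⟨mor F (b i) u, ?_, ?_⟩
    · rw [Set.mem_preimage, ← hχ₂', hu, hr₂]
      rfl
    · rw [mor_comp_apply, hab]

lemma isWeaklySpecial_top (X : C) :
    IsWeaklySpecial (⟨Set.univ, IrreducibleSpace.isIrreducible_univ _, isClosed_univ⟩ :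
      Subvariety F X) := by
  obtain ⟨T, ⟨hT⟩, hT'⟩ := IsDistinguished.final_object (F := F)
  have : Subsingleton (var F T) :=
    (str F T).homeomorph.injective.subsingleton (β := Spec (.of K))
  obtain ⟨x⟩ := (inferInstance : Nonempty (var F X))
  refine ⟨X, T, 𝟙 X, hT.from X, mor F (hT.from X) x, isClosed_discrete _, ?_⟩
  have : mor F (𝟙 X) '' (mor F (hT.from X) ⁻¹' {mor F (hT.from X) x}) = Set.univ := by
    rw [mor_id]
    ext y
    simp [Subsingleton.elim (mor F (hT.from X) y) (mor F (hT.from X) x)]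
  rw [this]
  exact ⟨⟨IrreducibleSpace.isIrreducible_univ _, subset_rfl⟩, fun _ h _ => h.2⟩

end

section Defect

variable {K : Type u} [Field K] {C : Type v} [Category.{w} C] {F : C ⥤ Variety K}

/-! ### Dimension, defect, optimality -/

variable {X : C}

/-- The dimension of a subvariety, as a natural number; see `coe_dim`. -/
noncomputable def dim (V : Subvariety F X) : ℕ :=
  ((topologicalKrullDim ↥(V : Set (var F X))).unbotD 0).toNat

lemma coe_dim (V : Subvariety F X) :
    ((dim V : ℕ) : WithBot ℕ∞) = topologicalKrullDim ↥(V : Set (var F X)) := by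
  obtain ⟨N, hN⟩ := exists_topologicalKrullDim_le F X
  have h1 := (topologicalKrullDim_subspace_le (var F X) (V : Set (var F X))).trans hN
  have : Nonempty (IrreducibleCloseds ↥(V : Set (var F X))) := by
    have : IrreducibleSpace ↥(V : Set (var F X)) := Subtype.irreducibleSpace V.isIrreducible
    exact ⟨⟨Set.univ, IrreducibleSpace.isIrreducible_univ _, isClosed_univ⟩⟩
  have h0 : 0 ≤ topologicalKrullDim ↥(V : Set (var F X)) := Order.krullDim_nonneg
  rw [dim]
  generalize topologicalKrullDim ↥(V : Set (var F X)) = e at h0 h1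
  induction e with
  | bot => simp at h0
  | coe e =>
    have he : e ≠ ⊤ := by
      rintro rfl
      have h2 : (⊤ : ℕ∞) ≤ (N : ℕ∞) := by exact_mod_cast h1
      exact ENat.natCast_ne_top N (top_le_iff.1 h2)
    obtain ⟨k, rfl⟩ := ENat.ne_top_iff_exists.1 he
    simp

variable [IsDistinguished F]

/-- There is a smallest special subvariety containing `V`. -/
theorem exists_isLeast_special (V : Subvariety F X) :
    ∃ S, IsLeast {S : Subvariety F X | IsSpecial S ∧ V ≤ S} S :=
  exists_isLeast_irreducibleCloseds _ ⟨_, isSpecial_top X, fun _ _ => trivial⟩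
    fun _ h _ h' => exists_isSpecial_le_inf h.1 h'.1 h.2 h'.2

/-- There is a smallest weakly special subvariety containing `V`. -/
theorem exists_isLeast_weaklySpecial [IsAlgClosed K] (V : Subvariety F X) :
    ∃ S, IsLeast {S : Subvariety F X | IsWeaklySpecial S ∧ V ≤ S} S :=
  exists_isLeast_irreducibleCloseds _ ⟨_, isWeaklySpecial_top X, fun _ _ => trivial⟩
    fun _ h _ h' => exists_isWeaklySpecial_le_inf h.1 h'.1 h.2 h'.2

/-- `⟨V⟩`: the smallest special subvariety containing `V`. -/
noncomputable def specialHull (V : Subvariety F X) : Subvariety F X :=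
  (exists_isLeast_special V).choose

lemma isLeast_specialHull (V : Subvariety F X) :
    IsLeast {S : Subvariety F X | IsSpecial S ∧ V ≤ S} (specialHull V) :=
  (exists_isLeast_special V).choose_spec

/-- The defect `δ(V) = dim ⟨V⟩ - dim V`. -/
noncomputable def defect (V : Subvariety F X) : ℤ := (dim (specialHull V) : ℤ) - (dim V : ℤ)

/-- `W` is optimal for `V` in `X`. -/
def IsOptimal (V W : Subvariety F X) : Prop :=
  W ≤ V ∧ ∀ U : Subvariety F X, W < U → U ≤ V → defect W < defect U

variable [IsAlgClosed K]

/-- `⟨V⟩_ws`: the smallest weakly special subvariety containing `V`. -/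
noncomputable def weaklySpecialHull (V : Subvariety F X) : Subvariety F X :=
  (exists_isLeast_weaklySpecial V).choose

lemma isLeast_weaklySpecialHull (V : Subvariety F X) :
    IsLeast {S : Subvariety F X | IsWeaklySpecial S ∧ V ≤ S} (weaklySpecialHull V) :=
  (exists_isLeast_weaklySpecial V).choose_spec

/-- The weak defect `δ_ws(V) = dim ⟨V⟩_ws - dim V`. -/
noncomputable def weakDefect (V : Subvariety F X) : ℤ :=
  (dim (weaklySpecialHull V) : ℤ) - (dim V : ℤ)

/-- `W` is weakly optimal for `V` in `X`. -/
def IsWeaklyOptimal (V W : Subvariety F X) : Prop :=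
  W ≤ V ∧ ∀ U : Subvariety F X, W < U → U ≤ V → weakDefect W < weakDefect U

end Defect

/-! ### Weak finiteness and the Zilber-Pink statement -/

/-- A pair of morphisms `φ : Y ⟶ X` and `ψ : Y ⟶ Z`. -/
structure MorphismPair {C : Type v} [Category.{w} C] (X : C) where
  Y : C
  Z : C
  φ : Y ⟶ X
  ψ : Y ⟶ Z

section WeakFiniteness

variable {K : Type u} [Field K] [IsAlgClosed K] {C : Type v} [Category.{w} C]

/-- `T` is a finite set of pairs `(φ, ψ)` as required by the weak finiteness axiom for the subvariety `V` of `X`: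
for every `W` weakly optimal for `V` in `X`, there are `(φ, ψ)` in `T` and a `K`-rational point `z`
such that `φ` has finite fibers and `⟨W⟩_ws` is an irreducible component of `φ(ψ⁻¹(z))`. -/
def IsWeakFinitenessSet {F : C ⥤ Variety K} [IsDistinguished F] {X : C} (V : Subvariety F X)
    (T : Set (MorphismPair X)) : Prop :=
  T.Finite ∧ ∀ W : Subvariety F X, IsWeaklyOptimal V W →
    ∃ p ∈ T, ∃ z : var F p.Z, IsClosed {z} ∧
      (∀ x : var F X, (mor F p.φ ⁻¹' {x}).Finite) ∧
      IsComponentOf (weaklySpecialHull W : Set (var F X)) (mor F p.φ '' (mor F p.ψ ⁻¹' {z}))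

variable (F : C ⥤ Variety K) [IsDistinguished F]

/-- The weak finiteness axiom. -/
def WeakFiniteness : Prop :=
  ∀ (X : C) (V : Subvariety F X), ∃ T : Set (MorphismPair X), IsWeakFinitenessSet V T

/-- `ZP(X, m, d)`: every subvariety of `X` of dimension at most `m` contains at most finitely many
optimal subvarieties of defect at most `d`. -/
def ZP (X : C) (m d : ℕ) : Prop :=
  ∀ V : Subvariety F X, dim V ≤ m →
    {W : Subvariety F X | IsOptimal V W ∧ defect W ≤ d}.Finite

end WeakFiniteness

end ZilberPink

open ZilberPink

namespace ZilberPink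

/-! ### Commutative algebra: generic going down and transcendence degrees of quotients -/

/-! All dimension counts are made at scheme points: `tdeg x` is the transcendence degree of the
residue field of `x`, and by `dim_eq` the dimension of a subvariety is `tdeg` of its generic point.
Axiom (A4) then says that the nonempty fibers of a distinguished morphism are equidimensional, all
of one relative dimension (`exists_fiber_tdeg`).

Optimal subvarieties are weakly optimal, because δ - δ_ws does not increase when a subvariety is
enlarged (`dim_specialHull_add_le`). So for every optimal W the hull ⟨W⟩_ws is a component of
φ(ψ⁻¹(z)) for one of finitely many pairs (φ, ψ) with φ of finite fibers, and one such pair can be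
treated at a time. The generic point of W lifts to a point y of Y_φ with ψ(y) = z.

Let n be the relative dimension of ψ. Then dim ⟨W⟩_ws = n, and two inequalities connect X with Z_ψ:
dim ⟨z⟩ + n ≤ dim ⟨W⟩ (`dim_specialHull_add_dim_weaklySpecialHull_le`), and dim ⟨φ(u)⟩ ≤ dim ⟨ψ(u)⟩
+ n for every point u (`dim_specialHull_le`). The first gives δ({z}) ≤ δ(W) ≤ d.

Let E be a component of φ⁻¹(V) through y. If y is close to the generic point of E, every subvariety
U of the closure of ψ(E) with U strictly larger than {z} lifts to a subvariety of E through y whose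
dimension exceeds that of W by at least dim U (`exists_isOpen_forall_tdeg_add_le`). Its image in V
is strictly larger than W, and optimality of W with the two inequalities yields δ({z}) < δ(U). Hence
{z} is optimal for the closure of ψ(E), which has dimension at most dim V ≤ m, and the hypothesis on
points of Z_ψ leaves finitely many z. Over a fixed z, weak optimality forces W to be the closure of
the image of a component of E ∩ ψ⁻¹(z), so finitely many W remain. The points of E that are not
close to its generic point form a proper closed subset, which Noetherian induction handles. -/

/-- Passing to the quotient by a nonzero prime lowers the transcendence degree. -/
lemma trdeg_quotient_lt {K A : Type u} [Field K] [CommRing A] [IsDomain A] [Algebra K A]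
    [Algebra.FiniteType K A] (Q : Ideal A) [Q.IsPrime] (hQ : Q ≠ ⊥) :
    Algebra.trdeg K (A ⧸ Q) < Algebra.trdeg K A := by
  by_contra! hle
  have : FaithfulSMul K (A ⧸ Q) :=
    (faithfulSMul_iff_algebraMap_injective K (A ⧸ Q)).2 (algebraMap K (A ⧸ Q)).injective
  obtain ⟨s, hs⟩ := exists_isTranscendenceBasis K (A ⧸ Q)
  let y : s → A := fun i => (Ideal.Quotient.mk_surjective i.1).choose
  have hy : (Ideal.Quotient.mkₐ K Q) ∘ y = ((↑) : s → A ⧸ Q) :=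
    funext fun i => (Ideal.Quotient.mk_surjective i.1).choose_spec
  have hind' : AlgebraicIndependent K ((Ideal.Quotient.mkₐ K Q) ∘ y) := by rw [hy]; exact hs.1
  have hind : AlgebraicIndependent K y := .of_comp _ hind'
  have hbasis : IsTranscendenceBasis K y :=
    hind.isTranscendenceBasis_of_trdeg_le trdeg_lt_aleph0_of_finiteType
      (hle.trans_eq hs.cardinalMk_eq_trdeg.symm)
  have halg := hbasis.isAlgebraic
  -- If the degree did not drop, the lifts `y` would be a transcendence basis of `A`. A nonzero
  -- element of `Q` would be algebraic over `K[y]`, so `Q` would contain a nonzero polynomial in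
  -- `y`, an algebraic relation among the basis elements of the quotient.
  obtain ⟨f, hfQ, hf⟩ := Submodule.exists_mem_ne_zero_of_ne_bot hQ
  have hne := Ideal.comap_ne_bot_of_algebraic_mem hf hfQ (halg.1 f)
  obtain ⟨⟨b, hb⟩, hbQ, hb0⟩ := Submodule.exists_mem_ne_zero_of_ne_bot hne
  rw [Algebra.adjoin_range_eq_range_aeval] at hb
  obtain ⟨p, rfl⟩ := hb
  refine hb0 (Subtype.ext ?_)
  have hp : p = 0 := by
    apply hind'
    have h : Ideal.Quotient.mkₐ K Q (MvPolynomial.aeval y p) = 0 := Ideal.Quotient.eq_zero_iff_mem.2 hbQ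
    rw [map_zero, ← h, MvPolynomial.comp_aeval_apply]
    rfl
  change MvPolynomial.aeval y p = 0
  rw [hp, map_zero]

/-- If `A` is contained in a localization of a subalgebra `A₀`, then the primes of `A₀` that survive
in the localization extend to `A`. -/
lemma exists_isPrime_comap_val_eq {B A : Type u} [CommRing B] [CommRing A] [Algebra B A]
    (A₀ : Subalgebra B A) (g : B) (hg : ∀ a : A, ∃ n : ℕ, g ^ n • a ∈ A₀) (Q₀ : Ideal A₀)
    [Q₀.IsPrime] (hgQ : algebraMap B A₀ g ∉ Q₀) :
    ∃ Q : Ideal A, Q.IsPrime ∧ Q.comap A₀.val = Q₀ ∧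
      ∀ P : Ideal A, P.IsPrime → algebraMap B A g ∉ P → Q₀ ≤ P.comap A₀.val → Q ≤ P := by
  have hpow : ∀ n : ℕ, ∀ a : A₀, g ^ n • a ∈ Q₀ → a ∈ Q₀ := fun n a h => by
    rw [Algebra.smul_def, map_pow] at h
    exact (Ideal.IsPrime.mem_or_mem ‹_› h).resolve_left
      fun h => hgQ (Ideal.IsPrime.mem_of_pow_mem ‹_› _ h)
  -- The contraction to `A` of the extension of `Q₀` to the localization at `g`.
  let Q : Ideal A :=
    { carrier := {a | ∃ n : ℕ, ∃ q ∈ Q₀, (q : A) = g ^ n • a}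
      zero_mem' := ⟨0, 0, Q₀.zero_mem, by simp⟩
      add_mem' := by
        rintro a b ⟨n, q, hq, hqa⟩ ⟨m, r, hr, hrb⟩
        refine ⟨n + m, g ^ m • q + g ^ n • r, Q₀.add_mem (Submodule.smul_of_tower_mem _ _ hq)
          (Submodule.smul_of_tower_mem _ _ hr), ?_⟩
        simp only [Subalgebra.coe_add, Subalgebra.coe_smul, hqa, hrb, smul_add, smul_smul, pow_add,
          mul_comm]
      smul_mem' := by
        rintro c a ⟨n, q, hq, hqa⟩
        obtain ⟨m, hm⟩ := hg c
        refine ⟨m + n, ⟨_, hm⟩ * q, Q₀.mul_mem_left _ hq, ?_⟩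
        rw [Subalgebra.coe_mul, hqa, smul_eq_mul, smul_mul_smul_comm, ← pow_add] }
  have hQ : Q.comap A₀.val = Q₀ := by
    ext a
    constructor
    · rintro ⟨n, q, hq, hqa⟩
      refine hpow n a ?_
      convert hq
      exact Subtype.ext hqa.symm
    · intro ha
      exact ⟨0, a, ha, by simp⟩
  refine ⟨Q, ⟨?_, ?_⟩, hQ, ?_⟩
  · intro h
    apply Ideal.IsPrime.ne_top ‹Q₀.IsPrime›
    rw [← hQ, h, Ideal.comap_top]
  · rintro a b ⟨n, q, hq, hqa⟩
    obtain ⟨k, hk⟩ := hg a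
    obtain ⟨l, hl⟩ := hg b
    have : (⟨_, hk⟩ : A₀) * ⟨_, hl⟩ ∈ Q₀ := by
      refine hpow n _ ?_
      have : g ^ n • ((⟨_, hk⟩ : A₀) * ⟨_, hl⟩) = g ^ (k + l) • q := by
        apply Subtype.ext
        rw [Subalgebra.coe_smul, Subalgebra.coe_smul, Subalgebra.coe_mul, hqa, smul_mul_smul_comm,
          ← pow_add, smul_smul, smul_smul, mul_comm]
      rw [this]
      exact Submodule.smul_of_tower_mem _ _ hq
    exact (Ideal.IsPrime.mem_or_mem ‹_› this).imp (fun h => ⟨k, _, h, rfl⟩) fun h => ⟨l, _, h, rfl⟩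
  · rintro P hP hgP hle a ⟨n, q, hq, hqa⟩
    have h : (q : A) ∈ P := hle hq
    rw [hqa, Algebra.smul_def, map_pow] at h
    exact (hP.mem_or_mem h).resolve_left fun h => hgP (hP.mem_of_pow_mem _ h)

/-- An algebraic algebra of finite type over a domain is generically finite. -/
lemma exists_finite_subalgebra (B A : Type u) [CommRing B] [IsDomain B] [CommRing A]
    [Algebra B A] [Algebra.FiniteType B A] [Algebra.IsAlgebraic B A] :
    ∃ (g : B) (A₀ : Subalgebra B A), g ≠ 0 ∧ Module.Finite B A₀ ∧
      ∀ a : A, ∃ n : ℕ, g ^ n • a ∈ A₀ := by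
  obtain ⟨s, hs⟩ := (inferInstance : Algebra.FiniteType B A).out
  obtain ⟨g, hg, hint⟩ := Algebra.IsAlgebraic.exists_integral_multiples B s
  refine ⟨g, Algebra.adjoin B ((fun z => g • z) '' (s : Set A)), hg, ?_, fun a => ?_⟩
  · refine Module.Finite.iff_fg.2 (fg_adjoin_of_finite (s.finite_toSet.image _) ?_)
    rintro _ ⟨z, hz, rfl⟩
    exact hint z hz
  · have ha : a ∈ Algebra.adjoin B (s : Set A) := by rw [hs]; trivial
    have hup : ∀ (n m : ℕ) (a : A), n ≤ m →
        g ^ n • a ∈ Algebra.adjoin B ((fun z => g • z) '' (s : Set A)) →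
        g ^ m • a ∈ Algebra.adjoin B ((fun z => g • z) '' (s : Set A)) := fun n m a h h' => by
      obtain ⟨k, rfl⟩ := Nat.exists_eq_add_of_le' h
      rw [pow_add, mul_smul]
      exact Subalgebra.smul_mem _ h' _
    induction ha using Algebra.adjoin_induction with
    | mem z hz => exact ⟨1, by rw [pow_one]; exact Algebra.subset_adjoin ⟨z, hz, rfl⟩⟩
    | algebraMap b => exact ⟨0, by rw [pow_zero, one_smul]; exact Subalgebra.algebraMap_mem _ _⟩
    | add x y _ _ hx hy =>
      obtain ⟨n, hn⟩ := hx
      obtain ⟨m, hm⟩ := hy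
      refine ⟨n + m, ?_⟩
      rw [smul_add]
      exact Subalgebra.add_mem _ (hup _ _ _ (by omega) hn) (hup _ _ _ (by omega) hm)
    | mul x y _ _ hx hy =>
      obtain ⟨n, hn⟩ := hx
      obtain ⟨m, hm⟩ := hy
      refine ⟨n + m, ?_⟩
      rw [pow_add, ← smul_mul_smul_comm]
      exact Subalgebra.mul_mem _ hn hm

/-- A finite algebra over a Noetherian domain generically satisfies going down. -/
lemma exists_forall_going_down_of_finite (B A : Type u) [CommRing B] [IsDomain B]
    [IsNoetherianRing B] [CommRing A] [Algebra B A] [Module.Finite B A] :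
    ∃ r : B, r ≠ 0 ∧ ∀ P : Ideal A, P.IsPrime → algebraMap B A r ∉ P →
      ∀ p : Ideal B, p.IsPrime → p ≤ P.comap (algebraMap B A) →
        ∃ Q : Ideal A, Q.IsPrime ∧ Q ≤ P ∧ Q.comap (algebraMap B A) = p := by
  have : Module.FinitePresentation B A := Module.finitePresentation_of_finite B A
  -- Over the fraction field `A` becomes a vector space, hence free. Freeness spreads out to the
  -- localization at a single `r`, where flatness gives going down.
  obtain ⟨r, hr, hfree, -⟩ := Module.FinitePresentation.exists_free_localizedModule_powers
    (nonZeroDivisors B) (LocalizedModule.mkLinearMap (nonZeroDivisors B) A) (FractionRing B)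
  refine ⟨r, nonZeroDivisors.ne_zero hr, fun P hP hrP p hp hpP => ?_⟩
  let M := Submonoid.powers r
  let A' := Localization (Algebra.algebraMapSubmonoid A M)
  let e : LocalizedModule.Away r A ≃ₗ[Localization M] A' :=
    (IsLocalizedModule.iso M (IsScalarTower.toAlgHom B A A').toLinearMap).extendScalarsOfIsLocalization
      M (Localization M)
  have hfree' : Module.Free (Localization M) A' := Module.Free.of_equiv e
  have hgd : Algebra.HasGoingDown B A' := Algebra.HasGoingDown.trans B (Localization M) A'
  have hdisj : Disjoint (Algebra.algebraMapSubmonoid A M : Set A) P := by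
    rw [Set.disjoint_left]
    rintro _ ⟨_, ⟨n, rfl⟩, rfl⟩ h
    rw [SetLike.mem_coe, map_pow] at h
    exact hrP (hP.mem_of_pow_mem _ h)
  let P' : Ideal A' := P.map (algebraMap A A')
  have hP' : P'.IsPrime := IsLocalization.isPrime_of_isPrime_disjoint _ A' P hP hdisj
  have hPP' : P'.comap (algebraMap A A') = P :=
    IsLocalization.under_map_of_isPrime_disjoint _ A' hP hdisj
  have hover : P'.LiesOver (P.comap (algebraMap B A)) := ⟨by
    rw [Ideal.under_def, IsScalarTower.algebraMap_eq B A A', ← Ideal.comap_comap, hPP']⟩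
  obtain ⟨Q', hQ', hQ'prime, hQ'p⟩ := Ideal.exists_ideal_le_liesOver_of_le (R := B) P' hpP
  refine ⟨Q'.comap (algebraMap A A'), inferInstance, (Ideal.comap_mono hQ').trans hPP'.le, ?_⟩
  rw [Ideal.comap_comap, ← IsScalarTower.algebraMap_eq, hQ'p.over]

/-- An algebraic extension of finite type of a Noetherian domain generically satisfies going down,
lying over and integrality. -/
lemma exists_generic_going_down (B A : Type u) [CommRing B] [IsDomain B] [IsNoetherianRing B]
    [CommRing A] [Algebra B A] [Algebra.FiniteType B A] [Algebra.IsAlgebraic B A]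
    [FaithfulSMul B A] :
    ∃ g : B, g ≠ 0 ∧
      (∀ P : Ideal A, P.IsPrime → algebraMap B A g ∉ P → ∀ p : Ideal B, p.IsPrime →
        p ≤ P.comap (algebraMap B A) →
          ∃ Q : Ideal A, Q.IsPrime ∧ Q ≤ P ∧ Q.comap (algebraMap B A) = p) ∧
      (∀ p : Ideal B, p.IsPrime → g ∉ p →
        ∃ Q : Ideal A, Q.IsPrime ∧ Q.comap (algebraMap B A) = p) ∧
      ∀ a : A, ∃ n : ℕ, IsIntegral B (g ^ n • a) := by
  obtain ⟨g, A₀, hg, hfin, h⟩ := exists_finite_subalgebra B A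
  obtain ⟨r, hr, hgd⟩ := exists_forall_going_down_of_finite B A₀
  have hcomp : ∀ Q : Ideal A, (Q.comap A₀.val).comap (algebraMap B A₀) =
      Q.comap (algebraMap B A) := fun Q => rfl
  -- Away from `g` the algebras `A` and `A₀` agree; away from `r` the finite algebra `A₀` satisfies
  -- going down.
  refine ⟨g * r, mul_ne_zero hg hr, ?_, ?_, fun a => ?_⟩
  · intro P hP hgP p hp hpP
    rw [map_mul] at hgP
    have hgP' : algebraMap B A g ∉ P := fun h => hgP (P.mul_mem_right _ h)
    obtain ⟨Q₀, hQ₀, hle, hQ₀p⟩ := hgd (P.comap A₀.val) inferInstance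
      (fun h => hgP (P.mul_mem_left _ h)) p hp hpP
    obtain ⟨Q, hQ, hQQ₀, hmin⟩ := exists_isPrime_comap_val_eq A₀ g h Q₀ fun h => hgP' (hle h)
    exact ⟨Q, hQ, hmin P hP hgP' hle, by rw [← hcomp, hQQ₀, hQ₀p]⟩
  · intro p hp hgp
    have hinj : Function.Injective (algebraMap B A₀) := fun x y hxy =>
      FaithfulSMul.algebraMap_injective B A (congrArg Subtype.val hxy)
    obtain ⟨Q₀, -, hQ₀, hQ₀p⟩ := Ideal.exists_ideal_over_prime_of_isIntegral p (⊥ : Ideal A₀)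
      (by rw [Ideal.comap_bot_of_injective _ hinj]; exact bot_le)
    obtain ⟨Q, hQ, hQQ₀, -⟩ := exists_isPrime_comap_val_eq A₀ g h Q₀
      fun h => hgp (p.mul_mem_right r (hQ₀p ▸ h))
    exact ⟨Q, hQ, by rw [← hcomp, hQQ₀, hQ₀p]⟩
  · obtain ⟨n, hn⟩ := h a
    refine ⟨n, ?_⟩
    rw [mul_pow, mul_comm, mul_smul]
    exact ((Algebra.IsIntegral.isIntegral (R := B) (⟨_, hn⟩ : A₀)).map A₀.val).smul _

/-! ### Transcendence degrees in families: primes with prescribed contraction. -/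

/-- The transcendence degree, as a natural number. -/
noncomputable def natTrdeg (R A : Type u) [CommRing R] [CommRing A] [Algebra R A] : ℕ :=
  Cardinal.toNat (Algebra.trdeg R A)

lemma coe_natTrdeg (R A : Type u) [CommRing R] [IsDomain R] [CommRing A] [Algebra R A]
    [Algebra.FiniteType R A] : (natTrdeg R A : Cardinal.{u}) = Algebra.trdeg R A :=
  Cardinal.cast_toNat_of_lt_aleph0 trdeg_lt_aleph0_of_finiteType

lemma natTrdeg_add (K R A : Type u) [Field K] [CommRing R] [IsDomain R] [CommRing A] [IsDomain A]
    [Algebra K R] [Algebra K A] [Algebra R A] [IsScalarTower K R A] [FaithfulSMul R A]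
    [Algebra.FiniteType K R] [Algebra.FiniteType K A] :
    natTrdeg K R + natTrdeg R A = natTrdeg K A := by
  have : Algebra.FiniteType R A := .of_restrictScalars_finiteType K R A
  have : FaithfulSMul K R := (faithfulSMul_iff_algebraMap_injective K R).2 (algebraMap K R).injective
  have h := _root_.trdeg_add_eq K R (A := A)
  rw [← coe_natTrdeg, ← coe_natTrdeg, ← coe_natTrdeg] at h
  exact_mod_cast h

lemma exists_isTranscendenceBasis_fin (R A : Type u) [CommRing R] [IsDomain R] [CommRing A]
    [IsDomain A] [Algebra R A] [FaithfulSMul R A] [Algebra.FiniteType R A] :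
    ∃ x : Fin (natTrdeg R A) → A, IsTranscendenceBasis R x := by
  obtain ⟨s, hs⟩ := exists_isTranscendenceBasis R A
  have hcard : Cardinal.mk s = (natTrdeg R A : Cardinal.{u}) := by
    rw [coe_natTrdeg, hs.cardinalMk_eq_trdeg]
  obtain ⟨e⟩ := Cardinal.mk_eq_nat_iff.1 hcard
  exact ⟨_, (isTranscendenceBasis_equiv e.symm).2 hs⟩

/-- Going down is needed over the polynomial ring itself, since its primes are constructed by hand;
the isomorphism with the subalgebra generated by the basis transports algebraicity. -/
lemma isAlgebraic_mvPolynomial {R A : Type u} [CommRing R] [IsDomain R] [CommRing A]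
    [IsDomain A] [Algebra R A] {n : ℕ} {x : Fin n → A} (hx : IsTranscendenceBasis R x)
    [Algebra (MvPolynomial (Fin n) R) A]
    (h : algebraMap (MvPolynomial (Fin n) R) A = (MvPolynomial.aeval x).toRingHom) :
    Algebra.IsAlgebraic (MvPolynomial (Fin n) R) A := by
  have := hx.isAlgebraic
  refine Algebra.IsAlgebraic.of_ringHom_of_comp_eq (S := Algebra.adjoin R (Set.range x)) (B := A)
    hx.1.aevalEquiv (RingHom.id A) hx.1.aevalEquiv.surjective Function.injective_id ?_
  rw [h]
  ext p
  · simp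
  · simp

/-- Over a dense open subset of the spectrum of `A`, generalizations in the spectrum of `R` lift, and
the relative transcendence degree does not decrease. -/
lemma exists_forall_natTrdeg_add_le (K R A : Type u) [Field K] [CommRing R] [IsDomain R]
    [CommRing A] [IsDomain A] [Algebra K R] [Algebra K A] [Algebra R A] [IsScalarTower K R A]
    [FaithfulSMul R A] [Algebra.FiniteType K R] [Algebra.FiniteType K A] :
    ∃ s : A, s ≠ 0 ∧ ∀ P : Ideal A, P.IsPrime → s ∉ P → ∀ p : Ideal R, p.IsPrime →
      p ≤ P.comap (algebraMap R A) → ∃ Q : Ideal A, Q.IsPrime ∧ Q ≤ P ∧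
        Q.comap (algebraMap R A) = p ∧ natTrdeg K (R ⧸ p) + natTrdeg K (A ⧸ P) ≤
          natTrdeg K (A ⧸ Q) + natTrdeg K (R ⧸ P.comap (algebraMap R A)) := by
  have : Algebra.FiniteType R A := .of_restrictScalars_finiteType K R A
  have : IsNoetherianRing R := Algebra.FiniteType.isNoetherianRing K R
  obtain ⟨x, hx⟩ := exists_isTranscendenceBasis_fin R A
  generalize natTrdeg R A = n at x hx
  let _ : Algebra (MvPolynomial (Fin n) R) A := (MvPolynomial.aeval x).toRingHom.toAlgebra
  have hmap : algebraMap (MvPolynomial (Fin n) R) A = (MvPolynomial.aeval x).toRingHom := rfl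
  have : IsScalarTower R (MvPolynomial (Fin n) R) A := .of_algebraMap_eq fun r => by
    rw [hmap]; simp
  have : Algebra.IsAlgebraic (MvPolynomial (Fin n) R) A := isAlgebraic_mvPolynomial hx hmap
  have : Algebra.FiniteType (MvPolynomial (Fin n) R) A := .of_restrictScalars_finiteType R _ A
  have : FaithfulSMul (MvPolynomial (Fin n) R) A :=
    (faithfulSMul_iff_algebraMap_injective _ _).2 hx.1
  obtain ⟨g, hg, hgd, -, hint⟩ := exists_generic_going_down (MvPolynomial (Fin n) R) A
  refine ⟨algebraMap _ A g, by simpa using hg, fun P hP hgP p hp hpP => ?_⟩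
  have hker : RingHom.ker (MvPolynomial.map (σ := Fin n) (Ideal.Quotient.mk p)) =
      p.map MvPolynomial.C := by
    rw [MvPolynomial.ker_map, Ideal.mk_ker]
  have hprime : (p.map (MvPolynomial.C (σ := Fin n))).IsPrime := hker ▸ RingHom.ker_isPrime _
  have hcomap : ∀ I : Ideal A, (I.comap (algebraMap (MvPolynomial (Fin n) R) A)).comap
      MvPolynomial.C = I.comap (algebraMap R A) := fun I => by
    rw [Ideal.comap_comap, IsScalarTower.algebraMap_eq R (MvPolynomial (Fin n) R) A]
    rfl
  -- Going down is applied to the extension of `p` to `R[x]`, not to `p`: it is the generic point of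
  -- affine `n`-space over `p`, which makes the fiber dimension at `Q` at least `n`.
  obtain ⟨Q, hQ, hQP, hQp⟩ := hgd P hP hgP _ hprime (by
    rw [Ideal.map_le_iff_le_comap, hcomap]
    exact hpP)
  have hQp' : Q.comap (algebraMap R A) = p := by
    rw [← hcomap, hQp, ← hker]
    ext r
    simp [RingHom.mem_ker, Ideal.Quotient.eq_zero_iff_mem]
  refine ⟨Q, hQ, hQP, hQp', ?_⟩
  have hQover : Q.LiesOver p := ⟨hQp'.symm⟩
  have hPover : P.LiesOver (P.comap (algebraMap R A)) := ⟨rfl⟩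
  have hfQ : Algebra.FiniteType (R ⧸ p) (A ⧸ Q) := .of_restrictScalars_finiteType K _ _
  have hfP : Algebra.FiniteType (R ⧸ P.comap (algebraMap R A)) (A ⧸ P) :=
    .of_restrictScalars_finiteType K _ _
  have hmk : ∀ (i : Ideal R) (I : Ideal A) [I.LiesOver i] (f : MvPolynomial (Fin n) R),
      Ideal.Quotient.mk I (algebraMap _ A f) =
        MvPolynomial.aeval (fun j => Ideal.Quotient.mk I (x j))
          (MvPolynomial.map (Ideal.Quotient.mk i) f) := by
    intro i I _ f
    rw [hmap]
    induction f using MvPolynomial.induction_on with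
    | C r => simp [Ideal.Quotient.algebraMap_mk_of_liesOver]
    | add f g hf hg => rw [map_add, map_add, hf, hg, map_add, map_add]
    | mul_X f j hf => rw [map_mul, map_mul, hf]; simp
  have h1 : n ≤ natTrdeg (R ⧸ p) (A ⧸ Q) := by
    have hind : AlgebraicIndependent (R ⧸ p) fun i => Ideal.Quotient.mk Q (x i) := by
      rw [AlgebraicIndependent, injective_iff_map_eq_zero]
      intro f hf
      obtain ⟨f, rfl⟩ := MvPolynomial.map_surjective _ Ideal.Quotient.mk_surjective f
      have : f ∈ Q.comap (algebraMap (MvPolynomial (Fin n) R) A) := by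
        rw [Ideal.mem_comap, ← Ideal.Quotient.eq_zero_iff_mem, ← hf, hmk p]
      rwa [hQp, ← hker] at this
    have h := hind.lift_cardinalMk_le_trdeg
    rw [← coe_natTrdeg] at h
    simpa using h
  -- Since `g ∉ P`, every element of `A ⧸ P` has a nonzero multiple integral over the subalgebra
  -- generated by the images of the `n` basis elements.
  have h2 : natTrdeg (R ⧸ P.comap (algebraMap R A)) (A ⧸ P) ≤ n := by
    have halg : Algebra.IsAlgebraic (Algebra.adjoin (R ⧸ P.comap (algebraMap R A))
        (Set.range fun i => Ideal.Quotient.mk P (x i))) (A ⧸ P) := by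
      refine ⟨fun a => ?_⟩
      obtain ⟨a, rfl⟩ := Ideal.Quotient.mk_surjective a
      obtain ⟨m, hm⟩ := hint a
      have hmem : ∀ f : MvPolynomial (Fin n) R, Ideal.Quotient.mk P (algebraMap _ A f) ∈
          Algebra.adjoin (R ⧸ P.comap (algebraMap R A))
            (Set.range fun i => Ideal.Quotient.mk P (x i)) := fun f => by
        rw [hmk (P.comap (algebraMap R A)), Algebra.adjoin_range_eq_range_aeval]
        exact ⟨_, rfl⟩
      refine IsAlgebraic.of_smul_isIntegral (y := ⟨_, hmem (g ^ m)⟩) ?_ ?_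
      · rw [isNilpotent_iff_eq_zero]
        intro h
        have h' : Ideal.Quotient.mk P (algebraMap _ A (g ^ m)) = 0 := congrArg Subtype.val h
        rw [Ideal.Quotient.eq_zero_iff_mem, map_pow] at h'
        exact hgP (hP.mem_of_pow_mem _ h')
      · convert hm.map_of_comp_eq (((Ideal.Quotient.mk P).comp (algebraMap _ A)).codRestrict
          (Algebra.adjoin (R ⧸ P.comap (algebraMap R A))
            (Set.range fun i => Ideal.Quotient.mk P (x i))) hmem) (Ideal.Quotient.mk P) rfl using 1
        rw [Algebra.smul_def (g ^ m) a, map_mul]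
        rfl
    have h := Algebra.IsAlgebraic.trdeg_le_cardinalMk (R ⧸ P.comap (algebraMap R A))
      (Set.range fun i => Ideal.Quotient.mk P (x i))
    rw [← coe_natTrdeg] at h
    have h' := (Cardinal.lift_le.{0}.2 h).trans Cardinal.mk_range_le_lift
    simpa using h'
  have h3 := natTrdeg_add K (R ⧸ p) (A ⧸ Q)
  have h4 := natTrdeg_add K (R ⧸ P.comap (algebraMap R A)) (A ⧸ P)
  omega

/-- If the relative dimension of `A` over `R` is positive, then there are points of codimension one
in the generic fiber, outside of any given hypersurface. -/
lemma exists_isPrime_comap_eq_bot (K R A : Type u) [Field K] [Infinite K] [CommRing R] [IsDomain R]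
    [CommRing A] [IsDomain A] [Algebra K R] [Algebra K A] [Algebra R A] [IsScalarTower K R A]
    [FaithfulSMul R A] [Algebra.FiniteType K R] [Algebra.FiniteType K A] (s : A) (hs : s ≠ 0)
    (hpos : 0 < natTrdeg R A) :
    ∃ Q : Ideal A, Q.IsPrime ∧ s ∉ Q ∧ Q ≠ ⊥ ∧ Q.comap (algebraMap R A) = ⊥ ∧
      natTrdeg K A ≤ natTrdeg K (A ⧸ Q) + 1 := by
  have : Algebra.FiniteType R A := .of_restrictScalars_finiteType K R A
  have : IsNoetherianRing R := Algebra.FiniteType.isNoetherianRing K R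
  have hadd := natTrdeg_add K R A
  obtain ⟨n, hn⟩ := Nat.exists_eq_add_one_of_ne_zero hpos.ne'
  obtain ⟨x, hx⟩ : ∃ x : Fin (n + 1) → A, IsTranscendenceBasis R x :=
    hn ▸ exists_isTranscendenceBasis_fin R A
  let _ : Algebra (MvPolynomial (Fin (n + 1)) R) A := (MvPolynomial.aeval x).toRingHom.toAlgebra
  have hmap : algebraMap (MvPolynomial (Fin (n + 1)) R) A = (MvPolynomial.aeval x).toRingHom := rfl
  have : IsScalarTower R (MvPolynomial (Fin (n + 1)) R) A := .of_algebraMap_eq fun r => by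
    rw [hmap]; simp
  have : Algebra.IsAlgebraic (MvPolynomial (Fin (n + 1)) R) A := isAlgebraic_mvPolynomial hx hmap
  have : Algebra.FiniteType (MvPolynomial (Fin (n + 1)) R) A := .of_restrictScalars_finiteType R _ A
  have : FaithfulSMul (MvPolynomial (Fin (n + 1)) R) A :=
    (faithfulSMul_iff_algebraMap_injective _ _).2 hx.1
  obtain ⟨g, hg, -, hlo, -⟩ := exists_generic_going_down (MvPolynomial (Fin (n + 1)) R) A
  -- A nonzero multiple of `s` in the polynomial ring: a prime that avoids `b` also avoids `s`.
  obtain ⟨b, hb, hb0⟩ := Submodule.exists_mem_ne_zero_of_ne_bot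
    (Ideal.comap_ne_bot_of_algebraic_mem (R := MvPolynomial (Fin (n + 1)) R) hs
      (Ideal.mem_span_singleton_self s) (Algebra.IsAlgebraic.isAlgebraic s))
  -- Restriction to the hyperplane `X₀ = c`. The desired prime lies over its kernel; since `K` is
  -- infinite, some `c` keeps `g * b` nonzero on the hyperplane.
  let θ (c : K) : MvPolynomial (Fin (n + 1)) R →ₐ[R] MvPolynomial (Fin n) R :=
    ((Polynomial.aeval (algebraMap K (MvPolynomial (Fin n) R) c)).restrictScalars R).comp
      (MvPolynomial.finSuccEquiv R n).toAlgHom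
  have hθ : ∀ c f, θ c f =
      (MvPolynomial.finSuccEquiv R n f).eval (algebraMap K (MvPolynomial (Fin n) R) c) :=
    fun _ _ => rfl
  obtain ⟨c, hc⟩ : ∃ c, θ c (g * b) ≠ 0 := by
    by_contra! h
    have hinj : Function.Injective (algebraMap K (MvPolynomial (Fin n) R)) :=
      (algebraMap K (MvPolynomial (Fin n) R)).injective
    have h0 : MvPolynomial.finSuccEquiv R n (g * b) = 0 :=
      Polynomial.eq_zero_of_infinite_isRoot _
        ((Set.infinite_range_of_injective hinj).mono (by rintro _ ⟨c, rfl⟩; exact h c))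
    exact mul_ne_zero hg hb0 (by simpa using h0)
  obtain ⟨Q, hQ, hQp⟩ := hlo (RingHom.ker (θ c)) (RingHom.ker_isPrime _) (by
    intro h
    rw [RingHom.mem_ker] at h
    exact hc (by rw [map_mul, h, zero_mul]))
  have hQR : Q.comap (algebraMap R A) = ⊥ := by
    rw [IsScalarTower.algebraMap_eq R (MvPolynomial (Fin (n + 1)) R) A, ← Ideal.comap_comap, hQp]
    rw [eq_bot_iff]
    intro r hr
    rw [Ideal.mem_comap, RingHom.mem_ker, AlgHom.commutes] at hr
    simpa using hr
  have hfaith : FaithfulSMul R (A ⧸ Q) := by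
    rw [faithfulSMul_iff_algebraMap_injective, RingHom.injective_iff_ker_eq_bot, ← hQR]
    ext r
    rw [RingHom.mem_ker, IsScalarTower.algebraMap_apply R A, Ideal.mem_comap]
    exact Ideal.Quotient.eq_zero_iff_mem
  have hsQ : s ∉ Q := fun h => by
    have hbQ : b ∈ Q.comap (algebraMap (MvPolynomial (Fin (n + 1)) R) A) :=
      (Q.span_singleton_le_iff_mem.2 h) hb
    rw [hQp, RingHom.mem_ker] at hbQ
    exact hc (by rw [map_mul, hbQ, mul_zero])
  have hQ0 : Q ≠ ⊥ := by
    rintro rfl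
    have h : MvPolynomial.X 0 - algebraMap K (MvPolynomial (Fin (n + 1)) R) c ∈
        RingHom.ker (θ c) := by
      rw [RingHom.mem_ker, map_sub, hθ, MvPolynomial.finSuccEquiv_X_zero, Polynomial.eval_X,
        IsScalarTower.algebraMap_apply K R (MvPolynomial (Fin (n + 1)) R), AlgHom.commutes,
        ← IsScalarTower.algebraMap_apply, sub_self]
    rw [← hQp, Ideal.comap_bot_of_injective _ (FaithfulSMul.algebraMap_injective _ A), Ideal.mem_bot, sub_eq_zero,
      IsScalarTower.algebraMap_apply K R (MvPolynomial (Fin (n + 1)) R)] at h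
    have := congrArg MvPolynomial.totalDegree h
    rw [MvPolynomial.totalDegree_X, MvPolynomial.algebraMap_eq, MvPolynomial.totalDegree_C] at this
    exact one_ne_zero this
  have hfQ : Algebra.FiniteType R (A ⧸ Q) := .of_restrictScalars_finiteType K _ _
  have hn' : n ≤ natTrdeg R (A ⧸ Q) := by
    have hind : AlgebraicIndependent R fun i : Fin n => Ideal.Quotient.mk Q (x i.succ) := by
      rw [AlgebraicIndependent, injective_iff_map_eq_zero]
      intro f hf
      have h1 : Ideal.Quotient.mk Q (algebraMap _ A (MvPolynomial.rename Fin.succ f)) = 0 := by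
        rw [← hf, hmap]
        change Ideal.Quotient.mkₐ R Q (MvPolynomial.aeval x (MvPolynomial.rename Fin.succ f)) = _
        rw [MvPolynomial.aeval_rename, MvPolynomial.comp_aeval_apply]
        rfl
      rw [Ideal.Quotient.eq_zero_iff_mem, ← Ideal.mem_comap, hQp, RingHom.mem_ker] at h1
      have h2 : (θ c).comp (MvPolynomial.rename Fin.succ) = AlgHom.id R _ := by
        ext i
        simp [hθ, MvPolynomial.finSuccEquiv_X_succ]
      exact (DFunLike.congr_fun h2 f).symm.trans h1
    have h := hind.lift_cardinalMk_le_trdeg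
    rw [← coe_natTrdeg] at h
    simpa using h
  have := natTrdeg_add K R (A ⧸ Q)
  exact ⟨Q, hQ, hsQ, hQ0, hQR, by omega⟩

/-! ### The transcendence degree of a point of a `K`-scheme -/

section PointDim

variable {K : Type u} [Field K]

/-- The structure homomorphism of the residue field of a point of a `K`-scheme. -/
noncomputable def residueFieldHom {X : Scheme.{u}} (s : X ⟶ Spec (.of K)) (x : X) :
    K →+* X.residueField x :=
  (Spec.preimage (X.fromSpecResidueField x ≫ s)).hom

/-- The transcendence degree over `K` of the residue field of a point. -/
noncomputable def pointDim {X : Scheme.{u}} (s : X ⟶ Spec (.of K)) (x : X) : ℕ :=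
  @natTrdeg K (X.residueField x) _ _ (residueFieldHom s x).toAlgebra

lemma residueFieldHom_comp {X Y : Scheme.{u}} (f : X ⟶ Y) (s : Y ⟶ Spec (.of K)) (x : X) :
    residueFieldHom (f ≫ s) x = (f.residueFieldMap x).hom.comp (residueFieldHom s (f x)) := by
  have h : Spec.preimage (X.fromSpecResidueField x ≫ f ≫ s) =
      Spec.preimage (Y.fromSpecResidueField (f x) ≫ s) ≫ f.residueFieldMap x := by
    apply Spec.map_injective
    rw [Spec.map_comp, Spec.map_preimage, Spec.map_preimage,
      Scheme.Hom.SpecMap_residueFieldMap_fromSpecResidueField_assoc]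
  exact congrArg CommRingCat.Hom.hom h

lemma pointDim_of_isOpenImmersion {X Y : Scheme.{u}} (f : X ⟶ Y) (s : Y ⟶ Spec (.of K)) (x : X)
    [IsOpenImmersion f] : pointDim (f ≫ s) x = pointDim s (f x) := by
  let _ := (residueFieldHom s (f x)).toAlgebra
  let _ := (residueFieldHom (f ≫ s) x).toAlgebra
  let e : Y.residueField (f x) ≃ₐ[K] X.residueField x :=
    { (asIso (f.residueFieldMap x)).commRingCatIsoToRingEquiv with
      commutes' := fun r => by
        exact (DFunLike.congr_fun (residueFieldHom_comp f s x) r).symm }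
  exact congrArg Cardinal.toNat e.symm.trdeg_eq

/-- The residue field is the fraction field of the quotient, hence algebraic over it. -/
lemma natTrdeg_residueField (A : Type u) [CommRing A] [Algebra K A] (p : Ideal A) [p.IsPrime] :
    natTrdeg K p.ResidueField = natTrdeg K (A ⧸ p) := by
  have : FaithfulSMul K (A ⧸ p) :=
    (faithfulSMul_iff_algebraMap_injective _ _).2 (algebraMap K (A ⧸ p)).injective
  have : FaithfulSMul (A ⧸ p) p.ResidueField :=
    (faithfulSMul_iff_algebraMap_injective _ _).2 p.injective_algebraMap_quotient_residueField
  have : Algebra.IsAlgebraic (A ⧸ p) p.ResidueField :=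
    IsLocalization.isAlgebraic _ (nonZeroDivisors (A ⧸ p))
  have h := trdeg_add_eq K (A ⧸ p) (A := p.ResidueField)
  rw [trdeg_eq_zero (R := A ⧸ p), add_zero] at h
  exact congrArg Cardinal.toNat h.symm

lemma pointDim_spec (A : Type u) [CommRing A] [Algebra K A] (a : PrimeSpectrum A) :
    pointDim (X := Spec (.of A)) (Spec.map (CommRingCat.ofHom (algebraMap K A))) a =
      natTrdeg K (A ⧸ a.asIdeal) := by
  let _ := (residueFieldHom (X := Spec (.of A))
    (Spec.map (CommRingCat.ofHom (algebraMap K A))) a).toAlgebra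
  have hcomm : residueFieldHom (X := Spec (.of A))
      (Spec.map (CommRingCat.ofHom (algebraMap K A))) a =
        (Scheme.Spec.residueFieldIso (.of A) a).inv.hom.comp
          (algebraMap K a.asIdeal.ResidueField) := by
    have h : Spec.preimage ((Spec (.of A)).fromSpecResidueField a ≫
        Spec.map (CommRingCat.ofHom (algebraMap K A))) =
          CommRingCat.ofHom (algebraMap K a.asIdeal.ResidueField) ≫
            (Scheme.Spec.residueFieldIso (.of A) a).inv := by
      apply Spec.map_injective
      have h := Scheme.Spec.map_residueFieldIso_inv_eq_fromSpecResidueField (.of A) a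
      refine (Spec.map_preimage _).trans ((congrArg (· ≫ _) h.symm).trans ?_)
      rw [Spec.map_comp, Category.assoc, ← Spec.map_comp]
      rfl
    exact congrArg CommRingCat.Hom.hom h
  let e : a.asIdeal.ResidueField ≃ₐ[K] (Spec (.of A)).residueField a :=
    { (Scheme.Spec.residueFieldIso (.of A) a).symm.commRingCatIsoToRingEquiv with
      commutes' := fun r => (DFunLike.congr_fun hcomm r).symm }
  rw [← natTrdeg_residueField]
  exact congrArg Cardinal.toNat e.symm.trdeg_eq

lemma pointDim_of_comp_eq_spec {X : Scheme.{u}} (s : X ⟶ Spec (.of K)) (A : CommRingCat.{u})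
    [Algebra K A] (i : Spec A ⟶ X) [IsOpenImmersion i]
    (h : i ≫ s = Spec.map (CommRingCat.ofHom (algebraMap K A))) (a : Spec A) :
    pointDim s (i a) = natTrdeg K (A ⧸ PrimeSpectrum.asIdeal a) := by
  rw [← pointDim_of_isOpenImmersion, h]
  exact pointDim_spec A a

/-! ### Specializations and generalizations of points, computed in affine charts. -/

/-- A morphism locally of finite type between schemes locally of finite type over `K` is, locally,
the map of spectra of a homomorphism of `K`-algebras of finite type. -/
lemma exists_chart {X Y : Scheme.{u}} (f : X ⟶ Y) (s : Y ⟶ Spec (.of K)) [LocallyOfFiniteType f]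
    [LocallyOfFiniteType s] (x : X) (O : X.Opens) (hx : x ∈ O) :
    ∃ (R A : Type u) (_ : CommRing R) (_ : CommRing A) (_ : Algebra K R) (_ : Algebra K A)
      (_ : Algebra R A) (_ : IsScalarTower K R A) (_ : Algebra.FiniteType K R)
      (_ : Algebra.FiniteType K A) (i : PrimeSpectrum A → X) (j : PrimeSpectrum R → Y),
      Topology.IsOpenEmbedding i ∧ Topology.IsOpenEmbedding j ∧
      (∀ a, f (i a) = j (PrimeSpectrum.comap (algebraMap R A) a)) ∧
      (∀ a, pointDim (f ≫ s) (i a) = natTrdeg K (A ⧸ a.asIdeal)) ∧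
      (∀ r, pointDim s (j r) = natTrdeg K (R ⧸ r.asIdeal)) ∧
      x ∈ Set.range i ∧ Set.range i ⊆ O := by
  obtain ⟨V, hV, hxV, -⟩ := exists_isAffineOpen_mem_and_subset (X := Y) (x := f x) (U := ⊤) trivial
  obtain ⟨U, hU, hxU, hUO⟩ := exists_isAffineOpen_mem_and_subset (X := X) (x := x)
    (U := O ⊓ f ⁻¹ᵁ V) ⟨hx, hxV⟩
  have hUV : U ≤ f ⁻¹ᵁ V := fun y hy => (hUO hy).2
  let φ := f.appLE V U hUV
  let κ : CommRingCat.of K ⟶ Γ(Y, V) := Spec.preimage (hV.fromSpec ≫ s)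
  have hκ : Spec.map κ = hV.fromSpec ≫ s := Spec.map_preimage _
  have hκft : κ.hom.FiniteType := by
    have : LocallyOfFiniteType (Spec.map κ) := by rw [hκ]; infer_instance
    exact (HasRingHomProperty.Spec_iff (P := @LocallyOfFiniteType)).1 this
  have hφft : φ.hom.FiniteType := f.finiteType_appLE hV hU hUV
  have hφ : Spec.map φ ≫ hV.fromSpec = hU.fromSpec ≫ f := IsAffineOpen.SpecMap_appLE_fromSpec _ _ _ _
  let _ := κ.hom.toAlgebra
  let _ := φ.hom.toAlgebra
  let _ := (φ.hom.comp κ.hom).toAlgebra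
  refine ⟨Γ(Y, V), Γ(X, U), inferInstance, inferInstance, inferInstance, inferInstance,
    inferInstance, .of_algebraMap_eq' rfl, hκft, hφft.comp hκft, hU.fromSpec, hV.fromSpec,
    hU.fromSpec.isOpenEmbedding, hV.fromSpec.isOpenEmbedding, fun a => ?_, fun a => ?_,
    fun r => ?_, ?_, ?_⟩
  · have h : (hU.fromSpec ≫ f) a = (Spec.map φ ≫ hV.fromSpec) a := by rw [hφ]
    exact h
  · have h : hU.fromSpec ≫ f ≫ s =
        Spec.map (CommRingCat.ofHom (algebraMap K Γ(X, U))) := by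
      rw [← reassoc_of% hφ, ← hκ, ← Spec.map_comp]
      rfl
    exact pointDim_of_comp_eq_spec _ Γ(X, U) hU.fromSpec h a
  · exact pointDim_of_comp_eq_spec _ Γ(Y, V) hV.fromSpec hκ.symm r
  · exact (hU.range_fromSpec.superset hxU)
  · exact hU.range_fromSpec.subset.trans fun y hy => (hUO hy).1

lemma natTrdeg_quotient_comap {A B : Type u} [CommRing A] [CommRing B] [Algebra K A] [Algebra K B]
    (f : A →ₐ[K] B) (hf : Function.Surjective f) (J : Ideal B) :
    natTrdeg K (A ⧸ J.comap f) = natTrdeg K (B ⧸ J) := by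
  have hker : RingHom.ker ((Ideal.Quotient.mkₐ K J).comp f) = J.comap f := by
    ext a
    exact Ideal.Quotient.eq_zero_iff_mem
  exact congrArg Cardinal.toNat ((Ideal.quotientEquivAlgOfEq K hker.symm).trans
    (Ideal.quotientKerAlgEquivOfSurjective
      (f := (Ideal.Quotient.mkₐ K J).comp f) (Ideal.Quotient.mk_surjective.comp hf))).trdeg_eq

/-- A morphism does not increase the transcendence degree of points. -/
lemma pointDim_map_le {X Y : Scheme.{u}} (f : X ⟶ Y) (s : Y ⟶ Spec (.of K)) [LocallyOfFiniteType f]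
    [LocallyOfFiniteType s] (x : X) : pointDim s (f x) ≤ pointDim (f ≫ s) x := by
  obtain ⟨R, A, _, _, _, _, _, _, _, _, i, j, -, -, hf, hi, hj, ⟨a, rfl⟩, -⟩ :=
    exists_chart f s x ⊤ trivial
  rw [hf, hi, hj]
  have : a.asIdeal.LiesOver (PrimeSpectrum.comap (algebraMap R A) a).asIdeal := ⟨rfl⟩
  have := natTrdeg_add K (R ⧸ (PrimeSpectrum.comap (algebraMap R A) a).asIdeal) (A ⧸ a.asIdeal)
  omega

/-- Proper specializations have smaller transcendence degree. -/
lemma pointDim_lt_of_specializes {X : Scheme.{u}} (s : X ⟶ Spec (.of K)) [LocallyOfFiniteType s]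
    {x y : X} (h : x ⤳ y) (hne : x ≠ y) : pointDim s y < pointDim s x := by
  obtain ⟨R, A, _, _, _, _, _, _, _, _, i, j, hiE, -, -, hi, -, ⟨b, rfl⟩, -⟩ :=
    exists_chart (𝟙 X) s y ⊤ trivial
  obtain ⟨a, rfl⟩ := h.mem_open hiE.isOpen_range ⟨b, rfl⟩
  rw [Category.id_comp] at hi
  rw [hi, hi]
  have hab : a ≤ b := (PrimeSpectrum.le_iff_specializes _ _).2 ((hiE.specializes_iff).1 h)
  have hne' : a.asIdeal ≠ b.asIdeal := fun h => hne (congrArg i (PrimeSpectrum.ext h))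
  have hb : (b.asIdeal.map (Ideal.Quotient.mk a.asIdeal)).comap (Ideal.Quotient.mk a.asIdeal) =
      b.asIdeal := Ideal.comap_map_mk hab
  have hprime : (b.asIdeal.map (Ideal.Quotient.mk a.asIdeal)).IsPrime :=
    Ideal.map_isPrime_of_surjective Ideal.Quotient.mk_surjective (by rwa [Ideal.mk_ker])
  have h1 : natTrdeg K (A ⧸ b.asIdeal) =
      natTrdeg K ((A ⧸ a.asIdeal) ⧸ b.asIdeal.map (Ideal.Quotient.mk a.asIdeal)) := by
    rw [← natTrdeg_quotient_comap (Ideal.Quotient.mkₐ K a.asIdeal) Ideal.Quotient.mk_surjective]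
    exact congrArg (fun I => natTrdeg K (A ⧸ I)) hb.symm
  have h2 := trdeg_quotient_lt (K := K) (b.asIdeal.map (Ideal.Quotient.mk a.asIdeal)) (by
    intro h0
    rw [h0, ← RingHom.ker_eq_comap_bot, Ideal.mk_ker] at hb
    exact hne' hb)
  rw [h1]
  rw [← coe_natTrdeg, ← coe_natTrdeg] at h2
  exact_mod_cast h2

/-- If `x` has positive transcendence degree over its image, then it has specializations
of codimension one in the fiber, in any given neighbourhood. -/
lemma exists_specializes_of_pointDim_lt [Infinite K] {X Y : Scheme.{u}} (f : X ⟶ Y)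
    (s : Y ⟶ Spec (.of K)) [LocallyOfFiniteType f] [LocallyOfFiniteType s] (x : X) (O : X.Opens)
    (hx : x ∈ O) (h : pointDim s (f x) < pointDim (f ≫ s) x) :
    ∃ y ∈ O, x ⤳ y ∧ y ≠ x ∧ f y = f x ∧ pointDim (f ≫ s) x ≤ pointDim (f ≫ s) y + 1 := by
  obtain ⟨R, A, _, _, _, _, _, _, _, _, i, j, hiE, -, hf, hi, hj, ⟨a, rfl⟩, hO⟩ :=
    exists_chart f s x O hx
  set q := PrimeSpectrum.comap (algebraMap R A) a with hq
  rw [hf, hi, hj, ← hq] at h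
  have : a.asIdeal.LiesOver q.asIdeal := ⟨rfl⟩
  have hadd := natTrdeg_add K (R ⧸ q.asIdeal) (A ⧸ a.asIdeal)
  -- The element to be avoided is taken to be `1`, because the chart already lies inside `O`.
  obtain ⟨Q, hQ, -, hQ0, hQq, hQdim⟩ := exists_isPrime_comap_eq_bot K (R ⧸ q.asIdeal)
    (A ⧸ a.asIdeal) 1 one_ne_zero (by omega)
  have hle : a.asIdeal ≤ Q.comap (Ideal.Quotient.mk a.asIdeal) := by
    conv_lhs => rw [← Ideal.mk_ker (I := a.asIdeal)]
    exact Ideal.ker_le_comap _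
  let b : PrimeSpectrum A := ⟨Q.comap (Ideal.Quotient.mk a.asIdeal), inferInstance⟩
  refine ⟨i b, hO ⟨b, rfl⟩, (hiE.specializes_iff).2
    ((PrimeSpectrum.le_iff_specializes _ _).1 hle), fun hba => hQ0 ?_, ?_, ?_⟩
  · have hba' : Q.comap (Ideal.Quotient.mk a.asIdeal) = a.asIdeal :=
      congrArg PrimeSpectrum.asIdeal (hiE.injective hba)
    rw [← Ideal.map_comap_of_surjective _ Ideal.Quotient.mk_surjective Q, hba',
      Ideal.map_quotient_self]
  · rw [hf, hf]
    congr 1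
    refine PrimeSpectrum.ext ?_
    change (Q.comap (Ideal.Quotient.mk a.asIdeal)).comap (algebraMap R A) = q.asIdeal
    have : (Q.comap (algebraMap (R ⧸ q.asIdeal) (A ⧸ a.asIdeal))).comap
        (Ideal.Quotient.mk q.asIdeal) = q.asIdeal := by
      rw [hQq, ← RingHom.ker_eq_comap_bot, Ideal.mk_ker]
    rw [← this, Ideal.comap_comap, Ideal.comap_comap]
    rfl
  · rw [hi, hi]
    refine hQdim.trans (Nat.add_le_add_right (le_of_eq ?_) 1)
    exact (natTrdeg_quotient_comap (Ideal.Quotient.mkₐ K a.asIdeal)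
      Ideal.Quotient.mk_surjective Q).symm

/-- Generic lifting of generalizations, without loss of relative transcendence degree. -/
lemma exists_isOpen_forall_pointDim_add_le {X Y : Scheme.{u}} (f : X ⟶ Y)
    (s : Y ⟶ Spec (.of K)) [LocallyOfFiniteType f] [LocallyOfFiniteType s] (x : X) :
    ∃ O : Set X, IsOpen O ∧ x ∈ O ∧ ∀ w ∈ O, x ⤳ w → ∀ y, f x ⤳ y → y ⤳ f w →
      ∃ z, x ⤳ z ∧ z ⤳ w ∧ f z = y ∧
        pointDim s y + pointDim (f ≫ s) w ≤ pointDim (f ≫ s) z + pointDim s (f w) := by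
  obtain ⟨R, A, _, _, _, _, _, _, _, _, i, j, hiE, hjE, hf, hi, hj, ⟨a, rfl⟩, -⟩ :=
    exists_chart f s x ⊤ trivial
  set q := PrimeSpectrum.comap (algebraMap R A) a with hq
  have : a.asIdeal.LiesOver q.asIdeal := ⟨rfl⟩
  -- Dividing by the primes of `x` and of `f x` makes `x` the generic point and gives an injective
  -- homomorphism of domains, as the algebraic statement requires.
  obtain ⟨g, hg, hmain⟩ := exists_forall_natTrdeg_add_le K (R ⧸ q.asIdeal) (A ⧸ a.asIdeal)
  obtain ⟨g, rfl⟩ := Ideal.Quotient.mk_surjective g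
  have hga : g ∉ a.asIdeal := fun h => hg (Ideal.Quotient.eq_zero_iff_mem.2 h)
  refine ⟨i '' PrimeSpectrum.basicOpen g, hiE.isOpenMap _ (PrimeSpectrum.basicOpen g).isOpen,
    ⟨a, hga, rfl⟩, ?_⟩
  rintro _ ⟨b, hb, rfl⟩ hab y hy hyb
  rw [hf] at hyb hy
  obtain ⟨r, rfl⟩ := hyb.mem_open hjE.isOpen_range ⟨_, rfl⟩
  have hab' : a.asIdeal ≤ b.asIdeal :=
    (PrimeSpectrum.le_iff_specializes _ _).2 ((hiE.specializes_iff).1 hab)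
  have hqr : q.asIdeal ≤ r.asIdeal :=
    (PrimeSpectrum.le_iff_specializes _ _).2 ((hjE.specializes_iff).1 hy)
  have hrb : r.asIdeal ≤ b.asIdeal.comap (algebraMap R A) :=
    (PrimeSpectrum.le_iff_specializes _ _).2 ((hjE.specializes_iff).1 hyb)
  have hsq : (algebraMap (R ⧸ q.asIdeal) (A ⧸ a.asIdeal)).comp (Ideal.Quotient.mk q.asIdeal) =
      (Ideal.Quotient.mk a.asIdeal).comp (algebraMap R A) := rfl
  have hb' : (b.asIdeal.map (Ideal.Quotient.mk a.asIdeal)).comap (Ideal.Quotient.mk a.asIdeal) =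
      b.asIdeal := Ideal.comap_map_mk hab'
  have hr' : (r.asIdeal.map (Ideal.Quotient.mk q.asIdeal)).comap (Ideal.Quotient.mk q.asIdeal) =
      r.asIdeal := Ideal.comap_map_mk hqr
  have hbp : (b.asIdeal.map (Ideal.Quotient.mk a.asIdeal)).IsPrime :=
    Ideal.map_isPrime_of_surjective Ideal.Quotient.mk_surjective (by rwa [Ideal.mk_ker])
  have hrp : (r.asIdeal.map (Ideal.Quotient.mk q.asIdeal)).IsPrime :=
    Ideal.map_isPrime_of_surjective Ideal.Quotient.mk_surjective (by rwa [Ideal.mk_ker])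
  obtain ⟨Q, hQ, hQb, hQr, hdim⟩ := hmain _ hbp (fun h => hb (hb'.le h)) _ hrp (by
    rw [Ideal.map_le_iff_le_comap, Ideal.comap_comap, hsq, ← Ideal.comap_comap, hb']
    exact hrb)
  let c : PrimeSpectrum A := ⟨Q.comap (Ideal.Quotient.mk a.asIdeal), inferInstance⟩
  have hac : a.asIdeal ≤ c.asIdeal := by
    conv_lhs => rw [← Ideal.mk_ker (I := a.asIdeal)]
    exact Ideal.ker_le_comap _
  have hcb : c.asIdeal ≤ b.asIdeal := (Ideal.comap_mono hQb).trans hb'.le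
  have hcr : PrimeSpectrum.comap (algebraMap R A) c = r := by
    refine PrimeSpectrum.ext ?_
    change (Q.comap (Ideal.Quotient.mk a.asIdeal)).comap (algebraMap R A) = r.asIdeal
    rw [← hr', ← hQr, Ideal.comap_comap, Ideal.comap_comap, hsq]
  refine ⟨i c, (hiE.specializes_iff).2 ((PrimeSpectrum.le_iff_specializes _ _).1 hac),
    (hiE.specializes_iff).2 ((PrimeSpectrum.le_iff_specializes _ _).1 hcb), by rw [hf, hcr], ?_⟩
  have key : ∀ (p : Ideal A) (p' : Ideal (A ⧸ a.asIdeal)),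
      p'.comap (Ideal.Quotient.mk a.asIdeal) = p →
        natTrdeg K ((A ⧸ a.asIdeal) ⧸ p') = natTrdeg K (A ⧸ p) := by
    rintro _ p' rfl
    exact (natTrdeg_quotient_comap (Ideal.Quotient.mkₐ K a.asIdeal)
      Ideal.Quotient.mk_surjective p').symm
  have key' : ∀ (p : Ideal R) (p' : Ideal (R ⧸ q.asIdeal)),
      p'.comap (Ideal.Quotient.mk q.asIdeal) = p →
        natTrdeg K ((R ⧸ q.asIdeal) ⧸ p') = natTrdeg K (R ⧸ p) := by
    rintro _ p' rfl
    exact (natTrdeg_quotient_comap (Ideal.Quotient.mkₐ K q.asIdeal)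
      Ideal.Quotient.mk_surjective p').symm
  rw [hf, hi, hi, hj, hj]
  rw [key _ _ hb', key _ _ rfl, key' _ _ hr', key' (b.asIdeal.comap (algebraMap R A)) _ (by
    rw [Ideal.comap_comap, hsq, ← Ideal.comap_comap, hb'])] at hdim
  exact hdim

end PointDim

/-! ### Points and irreducible closed subsets -/

section Points

variable {T : Type u} [TopologicalSpace T]

/-- The closure of a point. -/
def pointClosure (x : T) : IrreducibleCloseds T :=
  ⟨closure {x}, isIrreducible_singleton.closure, isClosed_closure⟩

lemma mem_pointClosure {x y : T} : y ∈ (pointClosure x : Set T) ↔ x ⤳ y :=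
  specializes_iff_mem_closure.symm

lemma pointClosure_le_iff {x : T} {V : IrreducibleCloseds T} :
    pointClosure x ≤ V ↔ x ∈ (V : Set T) :=
  ⟨fun h => h (subset_closure rfl), fun h => V.isClosed.closure_subset_iff.2 (by simpa using h)⟩

lemma pointClosure_le_pointClosure {x y : T} : pointClosure x ≤ pointClosure y ↔ y ⤳ x :=
  pointClosure_le_iff.trans mem_pointClosure

variable [QuasiSober T]

/-- The generic point of an irreducible closed subset. -/
noncomputable def gen (V : IrreducibleCloseds T) : T := V.isIrreducible.genericPoint

lemma closure_gen (V : IrreducibleCloseds T) : closure {gen V} = (V : Set T) :=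
  (V.isIrreducible.genericPoint_closure_eq).trans V.isClosed.closure_eq

lemma pointClosure_gen (V : IrreducibleCloseds T) : pointClosure (gen V) = V :=
  SetLike.coe_injective (closure_gen V)

lemma gen_mem (V : IrreducibleCloseds T) : gen V ∈ (V : Set T) :=
  pointClosure_le_iff.1 (pointClosure_gen V).le

lemma gen_specializes_iff {V : IrreducibleCloseds T} {x : T} : gen V ⤳ x ↔ x ∈ (V : Set T) := by
  rw [← mem_pointClosure, pointClosure_gen]

lemma gen_pointClosure [T0Space T] (x : T) : gen (pointClosure x) = x :=
  (Specializes.antisymm (gen_specializes_iff.2 (mem_pointClosure.2 specializes_rfl))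
    (mem_pointClosure.1 (gen_mem _))).eq

lemma gen_injective : Function.Injective (gen : IrreducibleCloseds T → T) := fun V W h => by
  rw [← pointClosure_gen V, h, pointClosure_gen]

/-- A nonempty irreducible fiber contains its generic point. -/
lemma exists_subset_closure_of_isIrreducible {T' : Type u} [TopologicalSpace T'] [T0Space T']
    {f : T → T'} (hf : Continuous f) {v : T'} {A : Set T} (hA : IsIrreducible A)
    (hAv : A ⊆ f ⁻¹' {v}) : ∃ w, f w = v ∧ closure {w} = closure A := by
  refine ⟨hA.genericPoint, ?_, hA.genericPoint_closure_eq⟩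
  obtain ⟨a, ha⟩ := hA.nonempty
  have h1 : hA.genericPoint ⤳ a := specializes_iff_mem_closure.2
    (hA.genericPoint_closure_eq.superset (subset_closure ha))
  have h2 : hA.genericPoint ∈ closure A := hA.genericPoint_closure_eq.subset (subset_closure rfl)
  have h3 : f hA.genericPoint ∈ closure {v} :=
    closure_mono (Set.image_subset_iff.2 hAv) (image_closure_subset_closure_image hf ⟨_, h2, rfl⟩)
  have h4 := h1.map hf
  rw [show f a = v from hAv ha] at h4
  exact (h4.antisymm (specializes_iff_mem_closure.2 h3)).eq

end Points

/-! ### Dimension of fibers -/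

section FiberDim

variable {K : Type u} [Field K]

lemma pointDim_id (x : Spec (.of K)) : pointDim (𝟙 (Spec (.of K))) x = 0 := by
  have h : 𝟙 (Spec (.of K)) = Spec.map (CommRingCat.ofHom (algebraMap K K)) :=
    Spec.map_id _ |>.symm
  rw [h]
  refine (pointDim_spec K x).trans ?_
  have : (PrimeSpectrum.asIdeal (R := K) x).IsPrime := PrimeSpectrum.isPrime (R := K) x
  have : FaithfulSMul K (K ⧸ PrimeSpectrum.asIdeal x) :=
    (faithfulSMul_iff_algebraMap_injective _ _).2
      (algebraMap K (K ⧸ PrimeSpectrum.asIdeal x)).injective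
  have : Algebra.IsAlgebraic K (K ⧸ PrimeSpectrum.asIdeal x) := inferInstance
  rw [natTrdeg, trdeg_eq_zero, map_zero]

variable [Infinite K] {X Y : Scheme.{u}} (f : X ⟶ Y) (s : Y ⟶ Spec (.of K))
  [LocallyOfFiniteType f] [LocallyOfFiniteType s]

/-- A morphism preserves the transcendence degree of points in finite fibers. -/
lemma pointDim_eq_of_finite {x : X} (h : (f ⁻¹' {f x}).Finite) :
    pointDim (f ≫ s) x = pointDim s (f x) := by
  refine le_antisymm ?_ (pointDim_map_le f s x)
  by_contra! hlt
  -- The proper specializations of `x` in its fiber are finite in number, so removing their closures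
  -- leaves a neighbourhood of `x` without any; a drop in transcendence degree would produce one
  -- there.
  have hfin : ({y | f y = f x ∧ y ≠ x ∧ x ⤳ y} : Set X).Finite := h.subset fun y hy => hy.1
  obtain ⟨y, hyO, hxy, hyx, hfy, -⟩ := exists_specializes_of_pointDim_lt f s x
    ⟨(⋃ y ∈ {y | f y = f x ∧ y ≠ x ∧ x ⤳ y}, closure {y})ᶜ,
      (hfin.isClosed_biUnion fun _ _ => isClosed_closure).isOpen_compl⟩ (by
        change x ∈ (⋃ y ∈ {y | f y = f x ∧ y ≠ x ∧ x ⤳ y}, closure {y})ᶜ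
        rintro h
        obtain ⟨y, ⟨-, hyx, hxy⟩, hx⟩ := Set.mem_iUnion₂.1 h
        exact hyx ((specializes_iff_mem_closure.2 hx).antisymm hxy).eq) hlt
  exact hyO (Set.mem_biUnion (x := y) ⟨hfy, hyx, hxy⟩ (subset_closure rfl))

/-- The dimension of a fiber of the restriction of a morphism to the closure of a point, near
this point. -/
lemma topologicalKrullDim_fiber (w : X) (U : Set X) (hU : IsOpen U) (hw : w ∈ U) :
    topologicalKrullDim ↥(closure {w} ∩ f ⁻¹' {f w} ∩ U) =
      ((pointDim (f ≫ s) w - pointDim s (f w) : ℕ) : WithBot ℕ∞) := by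
  set A := closure {w} ∩ f ⁻¹' {f w} ∩ U with hA
  apply le_antisymm
  -- Upper bound: generic points turn a chain of irreducible closed subsets into a chain of points
  -- over `f w` with strictly increasing transcendence degrees, all between those of `f w` and `w`.
  · let i : A → X := Subtype.val
    have hi : Continuous i := continuous_subtype_val
    let g : IrreducibleCloseds A → X := fun Z => gen (Z.map i hi)
    have hgw : ∀ Z, w ⤳ g Z := fun Z => by
      refine specializes_iff_mem_closure.2 ?_
      have h : (Z.map i hi : Set X) ⊆ closure {w} :=
        closure_minimal (by rintro _ ⟨a, -, rfl⟩; exact a.2.1.1) isClosed_closure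
      exact h (gen_mem _)
    have hgf : ∀ Z, f (g Z) = f w := fun Z => by
      obtain ⟨a, ha⟩ := Z.isIrreducible.nonempty
      have h1 : g Z ⤳ a := gen_specializes_iff.2 (subset_closure ⟨a, ha, rfl⟩)
      have h2 := h1.map f.continuous
      rw [show f a = f w from a.2.1.2] at h2
      exact (h2.antisymm ((hgw Z).map f.continuous)).eq
    have hmono : StrictMono fun Z => pointDim (f ≫ s) (g Z) := fun Z Z' h => by
      have h1 := IrreducibleCloseds.map_strictMono_of_isInducing
        (f := i) Topology.IsInducing.subtypeVal h
      refine pointDim_lt_of_specializes _ (gen_specializes_iff.2 (h1.le (gen_mem _))) ?_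
      intro h2
      exact h1.ne (gen_injective h2).symm
    refine iSup_le fun p => ?_
    have h1 := LTSeries.head_add_length_le_nat (p.map _ hmono)
    have h2 : pointDim s (f w) ≤ pointDim (f ≫ s) (g p.head) :=
      hgf p.head ▸ pointDim_map_le f s (g p.head)
    have h3 : pointDim (f ≫ s) (g p.last) ≤ pointDim (f ≫ s) w := by
      by_cases h : w = g p.last
      · rw [← h]
      · exact (pointDim_lt_of_specializes _ (hgw _) h).le
    simp only [LTSeries.head_map, LTSeries.last_map, LTSeries.map_length] at h1
    have h4 : p.length ≤ pointDim (f ≫ s) w - pointDim s (f w) := by omega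
    exact_mod_cast h4
  -- Lower bound: as long as the degree exceeds that of `f w`, one can specialize inside the fiber
  -- and inside `U` at a cost of at most one.
  · have key : ∀ n (y : A), n ≤ pointDim (f ≫ s) (y : X) - pointDim s (f w) →
        (n : ℕ∞) ≤ Order.height (pointClosure y) := by
      intro n
      induction n with
      | zero => simp
      | succ n ih =>
        rintro ⟨y, hy⟩ hn
        have hfy : f y = f w := hy.1.2
        obtain ⟨y', hyU, hyy, hne, hf, hdim⟩ := exists_specializes_of_pointDim_lt f s y ⟨U, hU⟩
          hy.2 (by rw [hfy]; dsimp only at hn; omega)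
        have hyA : y' ∈ A := ⟨⟨isClosed_closure.stableUnderSpecialization hyy hy.1.1,
          hf.trans hfy⟩, hyU⟩
        have hlt : pointClosure (⟨y', hyA⟩ : A) < pointClosure (⟨y, hy⟩ : A) := by
          refine lt_of_le_not_ge (pointClosure_le_pointClosure.2 ?_) fun h => hne ?_
          · exact Topology.IsInducing.subtypeVal.specializes_iff.1 hyy
          · have h1 := pointClosure_le_pointClosure.1 h
            exact (Topology.IsInducing.subtypeVal.specializes_iff.2 h1).antisymm hyy |>.eq
        have h1 := ih ⟨y', hyA⟩ (by dsimp only at hn ⊢; omega)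
        have h2 := Order.height_add_one_le hlt
        push_cast
        exact (add_le_add_left h1 1).trans h2
    have h1 := key _ ⟨w, ⟨subset_closure rfl, rfl⟩, hw⟩ le_rfl
    refine le_trans ?_ (Order.height_le_krullDim
      (pointClosure (⟨w, ⟨subset_closure rfl, rfl⟩, hw⟩ : A)))
    exact WithBot.coe_le_coe.2 h1

/-- In an irreducible fiber, the local dimension is the relative transcendence degree of the
generic point. -/
lemma localDim_of_isIrreducible {w x : X} (hirr : closure {w} = closure (f ⁻¹' {f w}))
    (hx : f x = f w) : localDim (f ⁻¹' {f w}) x =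
      ((pointDim (f ≫ s) w - pointDim s (f w) : ℕ) : WithBot ℕ∞) := by
  have h : ∀ U : {U : Set X // IsOpen U ∧ x ∈ U},
      topologicalKrullDim ↥(f ⁻¹' {f w} ∩ U.1) =
        ((pointDim (f ≫ s) w - pointDim s (f w) : ℕ) : WithBot ℕ∞) := by
    rintro ⟨U, hU, hxU⟩
    have hwx : w ⤳ x := specializes_iff_mem_closure.2 (hirr.superset (subset_closure hx))
    rw [← topologicalKrullDim_fiber f s w U hU (hwx.mem_open hU hxU)]
    rw [Set.inter_eq_right.2 (subset_closure.trans hirr.superset)]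
  have : Nonempty {U : Set X // IsOpen U ∧ x ∈ U} := ⟨⟨_, isOpen_univ, trivial⟩⟩
  rw [localDim, iInf_congr h, ciInf_const]

end FiberDim

/-! ### Transcendence degrees of points of distinguished varieties -/

section Distinguished

variable {K : Type u} [Field K] {C : Type v} [Category.{w} C] {F : C ⥤ Variety K}

instance instLocallyOfFiniteTypeMor {X Y : C} (f : X ⟶ Y) : LocallyOfFiniteType (mor F f) := by
  have : LocallyOfFiniteType (mor F f ≫ str F Y) := by rw [mor_str]; infer_instance
  exact locallyOfFiniteType_of_comp (mor F f) (str F Y)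

/-- The transcendence degree over `K` of the residue field of a point of `F(X)`. -/
noncomputable def tdeg {X : C} (x : var F X) : ℕ := pointDim (str F X) x

lemma tdeg_mor_le {X Y : C} (f : X ⟶ Y) (x : var F X) : tdeg (mor F f x) ≤ tdeg x := by
  rw [tdeg, tdeg, ← mor_str F f]
  exact pointDim_map_le _ _ _

lemma tdeg_lt_of_specializes {X : C} {x y : var F X} (h : x ⤳ y) (hne : x ≠ y) :
    tdeg y < tdeg x :=
  pointDim_lt_of_specializes _ h hne

lemma tdeg_le_of_specializes {X : C} {x y : var F X} (h : x ⤳ y) : tdeg y ≤ tdeg x := by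
  by_cases hne : x = y
  · rw [hne]
  · exact (tdeg_lt_of_specializes h hne).le

lemma exists_isOpen_forall_tdeg_add_le {X Y : C} (f : X ⟶ Y) (x : var F X) :
    ∃ O : Set (var F X), IsOpen O ∧ x ∈ O ∧ ∀ w ∈ O, x ⤳ w → ∀ y, mor F f x ⤳ y →
      y ⤳ mor F f w → ∃ z, x ⤳ z ∧ z ⤳ w ∧ mor F f z = y ∧
        tdeg y + tdeg w ≤ tdeg z + tdeg (mor F f w) := by
  simp only [tdeg]
  rw [← mor_str F f]
  exact exists_isOpen_forall_pointDim_add_le _ _ _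

lemma pointDim_str_id {X : C} (x : var F X) :
    pointDim (str F X ≫ 𝟙 _) x - pointDim (𝟙 (Spec (.of K))) (str F X x) = tdeg x := by
  rw [pointDim_id, Category.comp_id, tdeg, Nat.sub_zero]

/-- The generic point of a distinguished variety. -/
noncomputable abbrev eta (F : C ⥤ Variety K) (X : C) : var F X := genericPoint (var F X)

lemma eta_specializes {X : C} (x : var F X) : eta F X ⤳ x := genericPoint_specializes x

/-- By (A4) images are closed, so a special subvariety is the closure of the image of a generic
point. -/
lemma coe_pointClosure_eta [IsDistinguished F] {X Y : C} (f : X ⟶ Y) :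
    (pointClosure (mor F f (eta F X)) : Set (var F Y)) = Set.range (mor F f) := by
  apply subset_antisymm
  · exact (IsDistinguished.isClosed_range f).closure_subset_iff.2 (by simp)
  · rintro _ ⟨x, rfl⟩
    exact mem_pointClosure.2 ((eta_specializes x).map (mor F f).continuous)

lemma isSpecial_pointClosure_eta [IsDistinguished F] {X Y : C} (f : X ⟶ Y) :
    IsSpecial (pointClosure (mor F f (eta F X))) :=
  ⟨X, f, coe_pointClosure_eta f⟩

variable [IsAlgClosed K]

lemma tdeg_mor_eq {X Y : C} (f : X ⟶ Y) {x : var F X}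
    (h : (mor F f ⁻¹' {mor F f x}).Finite) : tdeg (mor F f x) = tdeg x := by
  have : Infinite K := IsAlgClosed.instInfinite
  rw [tdeg, tdeg, ← mor_str F f]
  exact (pointDim_eq_of_finite _ _ h).symm

/-- The spectrum of `K` has one point, so the dimension formula for fibers of the structure morphism
computes the dimension of `V` itself. -/
lemma dim_eq {X : C} (V : Subvariety F X) : dim V = tdeg (gen V) := by
  have : Infinite K := IsAlgClosed.instInfinite
  have h := topologicalKrullDim_fiber (str F X) (𝟙 _) (gen V) Set.univ isOpen_univ trivial
  have h1 : str F X ⁻¹' {str F X (gen V)} = Set.univ := by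
    ext x
    simp [Subsingleton.elim (α := PrimeSpectrum K) (str F X x) (str F X (gen V))]
  rw [pointDim_str_id, h1, Set.inter_univ, Set.inter_univ, closure_gen, ← coe_dim] at h
  exact_mod_cast h

lemma dim_pointClosure {X : C} (x : var F X) : dim (pointClosure x) = tdeg x := by
  rw [dim_eq, gen_pointClosure]

lemma tdeg_le_dim {X : C} {V : Subvariety F X} {x : var F X} (h : x ∈ (V : Set (var F X))) :
    tdeg x ≤ dim V := by
  rw [dim_eq]
  exact tdeg_le_of_specializes (gen_specializes_iff.2 h)

lemma dim_mono {X : C} {V W : Subvariety F X} (h : V ≤ W) : dim V ≤ dim W := by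
  rw [dim_eq V]
  exact tdeg_le_dim (h (gen_mem V))

lemma dim_strictMono {X : C} {V W : Subvariety F X} (h : V < W) : dim V < dim W := by
  rw [dim_eq, dim_eq]
  exact tdeg_lt_of_specializes (gen_specializes_iff.2 (h.le (gen_mem V)))
    fun h' => h.ne (gen_injective h').symm

/-- A point of positive transcendence degree has a proper specialization. -/
lemma tdeg_eq_zero {X : C} {x : var F X} (h : IsClosed {x}) : tdeg x = 0 := by
  have : Infinite K := IsAlgClosed.instInfinite
  by_contra hne
  obtain ⟨y, -, hxy, hyx, -⟩ := exists_specializes_of_pointDim_lt (str F X) (𝟙 _) x ⊤ trivial (by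
    rw [pointDim_id, Category.comp_id]
    exact Nat.pos_of_ne_zero hne)
  exact hyx (by simpa [h.closure_eq] using hxy.mem_closure)

/-! ### Fiber dimension for distinguished morphisms -/

/-- All components of fibers of a distinguished morphism have the same relative dimension. -/
theorem exists_fiber_tdeg [IsDistinguished F] {X Y : C} (f : X ⟶ Y) :
    ∃ n : ℕ, (∀ x : var F X, tdeg x ≤ tdeg (mor F f x) + n) ∧
      ∀ x : var F X, ∃ x', x' ⤳ x ∧ mor F f x' = mor F f x ∧ tdeg x' = tdeg (mor F f x) + n := by
  have : Infinite K := IsAlgClosed.instInfinite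
  obtain ⟨W, Z, φ₁, φ₂, φ₃, hcomm, hfin₁, hsurj, hfin₃, hirr, N, hN⟩ :=
    IsDistinguished.fiber_dimension (F := F) f
  have hcomm' : ∀ u, mor F f (mor F φ₁ u) = mor F φ₃ (mor F φ₂ u) := fun u => by
    rw [← mor_comp_apply, hcomm, mor_comp_apply]
  -- The fibers of `φ₂` are irreducible, so the constant local dimension `N` is the relative degree
  -- of the generic point `g` of the fiber. The morphisms `φ₁` and `φ₃` have finite fibers and
  -- preserve `tdeg`, so the count passes to `f`.
  have key : ∀ u : var F W, ∃ g, g ⤳ u ∧ mor F φ₂ g = mor F φ₂ u ∧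
      N = ((tdeg g - tdeg (mor F φ₂ u) : ℕ) : WithBot ℕ∞) := fun u => by
    obtain ⟨g, hg, hcl⟩ := exists_subset_closure_of_isIrreducible (mor F φ₂).continuous
      (hirr _ ⟨u, rfl⟩) subset_rfl
    refine ⟨g, specializes_iff_mem_closure.2 (hcl.superset (subset_closure rfl)), hg, ?_⟩
    rw [← hg] at hcl
    have h := localDim_of_isIrreducible (mor F φ₂) (str F Z) hcl hg.symm
    rw [mor_str, hg, hN u] at h
    exact h
  obtain ⟨u₀⟩ := (inferInstance : Nonempty (var F W))
  obtain ⟨g₀, -, -, h₀⟩ := key u₀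
  have hmain : ∀ u : var F W, ∃ g, g ⤳ u ∧ mor F φ₂ g = mor F φ₂ u ∧
      tdeg g = tdeg (mor F φ₂ u) + (tdeg g₀ - tdeg (mor F φ₂ u₀)) := fun u => by
    obtain ⟨g, hgu, hg, h⟩ := key u
    refine ⟨g, hgu, hg, ?_⟩
    rw [h₀] at h
    have h' : tdeg g₀ - tdeg (mor F φ₂ u₀) = tdeg g - tdeg (mor F φ₂ u) := by exact_mod_cast h
    have h'' : tdeg (mor F φ₂ u) ≤ tdeg g := hg ▸ tdeg_mor_le φ₂ g
    omega
  have h₁ : ∀ u : var F W, tdeg (mor F φ₁ u) = tdeg u := fun u =>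
    tdeg_mor_eq φ₁ ((mor F φ₁).finite_preimage_singleton _)
  have h₃ : ∀ u : var F Z, tdeg (mor F φ₃ u) = tdeg u := fun u => tdeg_mor_eq φ₃ (hfin₃ _)
  refine ⟨tdeg g₀ - tdeg (mor F φ₂ u₀), fun x => ?_, fun x => ?_⟩
  · obtain ⟨u, rfl⟩ := hsurj x
    obtain ⟨g, hgu, -, h⟩ := hmain u
    rw [hcomm', h₃, h₁, ← h]
    exact tdeg_le_of_specializes hgu
  · obtain ⟨u, rfl⟩ := hsurj x
    obtain ⟨g, hgu, hg, h⟩ := hmain u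
    refine ⟨mor F φ₁ g, hgu.map (mor F φ₁).continuous, ?_, ?_⟩
    · rw [hcomm', hg, hcomm']
    · rw [hcomm', h₃, h₁, h]

end Distinguished

/-! ### Special and weakly special hulls -/

section Hulls

variable {K : Type u} [Field K] {C : Type v} [Category.{w} C] {F : C ⥤ Variety K}
  [IsDistinguished F]

lemma le_specialHull {X : C} (V : Subvariety F X) : V ≤ specialHull V :=
  (isLeast_specialHull V).1.2

lemma specialHull_le {X : C} {V S : Subvariety F X} (hS : IsSpecial S) (h : V ≤ S) :
    specialHull V ≤ S :=
  (isLeast_specialHull V).2 ⟨hS, h⟩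

/-- The morphism to the final object has the whole variety as its only fiber. -/
lemma IsSpecial.isWeaklySpecial {X : C} {S : Subvariety F X} (hS : IsSpecial S) :
    IsWeaklySpecial S := by
  obtain ⟨Q, σ, hσ⟩ := hS
  obtain ⟨T, ⟨hT⟩, hT'⟩ := IsDistinguished.final_object (F := F)
  have : Subsingleton (var F T) :=
    (str F T).homeomorph.injective.subsingleton (β := Spec (.of K))
  obtain ⟨x⟩ := (inferInstance : Nonempty (var F Q))
  refine ⟨Q, T, σ, hT.from Q, mor F (hT.from Q) x, isClosed_discrete _, ?_⟩
  have : mor F (hT.from Q) ⁻¹' {mor F (hT.from Q) x} = Set.univ := by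
    ext y
    simp [Subsingleton.elim (mor F (hT.from Q) y) (mor F (hT.from Q) x)]
  rw [this, Set.image_univ, ← hσ]
  exact ⟨⟨S.isIrreducible, subset_rfl⟩, fun _ h _ => h.2⟩

variable [IsAlgClosed K]

lemma le_weaklySpecialHull {X : C} (V : Subvariety F X) : V ≤ weaklySpecialHull V :=
  (isLeast_weaklySpecialHull V).1.2

lemma weaklySpecialHull_le {X : C} {V S : Subvariety F X} (hS : IsWeaklySpecial S) (h : V ≤ S) :
    weaklySpecialHull V ≤ S :=
  (isLeast_weaklySpecialHull V).2 ⟨hS, h⟩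

lemma weaklySpecialHull_mono {X : C} {V W : Subvariety F X} (h : V ≤ W) :
    weaklySpecialHull V ≤ weaklySpecialHull W :=
  weaklySpecialHull_le (isLeast_weaklySpecialHull W).1.1 (h.trans (le_weaklySpecialHull W))

lemma weaklySpecialHull_le_specialHull {X : C} (V : Subvariety F X) :
    weaklySpecialHull V ≤ specialHull V :=
  weaklySpecialHull_le (isLeast_specialHull V).1.1.isWeaklySpecial (le_specialHull V)

/-- By (A2), φ(ψ⁻¹⟨U⟩) is a finite union of special subvarieties. One of them contains φ(y), and the
bound on fibers of ψ limits its dimension. -/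
lemma dim_specialHull_le {X Y Z : C} (φ : Y ⟶ X) (ψ : Y ⟶ Z) {n : ℕ}
    (hn : ∀ x : var F Y, tdeg x ≤ tdeg (mor F ψ x) + n) (U : Subvariety F Z) (y : var F Y)
    (hy : mor F ψ y ∈ (U : Set (var F Z))) :
    dim (specialHull (pointClosure (mor F φ y))) ≤ dim (specialHull U) + n := by
  obtain ⟨Q, σ, hσ⟩ := (isLeast_specialHull U).1.1
  obtain ⟨q, hq⟩ := hσ.subset (le_specialHull U hy)
  obtain ⟨_, D, a, b, hab, h⟩ := exists_inter_eq_iUnion (F := F) ψ σ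
  obtain ⟨i, t, rfl, rfl⟩ := h y q hq.symm
  refine (dim_mono (specialHull_le (isSpecial_pointClosure_eta (a i ≫ φ)) ?_)).trans ?_
  · rw [pointClosure_le_iff, coe_pointClosure_eta]
    exact ⟨t, mor_comp_apply F _ _ t⟩
  · rw [dim_pointClosure, mor_comp_apply]
    refine (tdeg_mor_le _ _).trans ((hn _).trans (Nat.add_le_add_right (tdeg_le_dim ?_) n))
    rw [hab]
    exact hσ.superset ⟨_, rfl⟩

/-- Pulling ⟨W⟩ back along φ gives a distinguished D → Y through a lift of the generic point of
⟨W⟩_ws. The image of D in Z is special and contains z, so it has dimension at least dim ⟨z⟩. The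
fiber of D over z already accounts for dim ⟨W⟩_ws plus the relative dimension of D → Y, and all
fibers of D → Z have equal dimension. As φ has finite fibers, the image of D in ⟨W⟩ is large enough.
-/
lemma dim_specialHull_add_dim_weaklySpecialHull_le {X Y Z : C} (φ : Y ⟶ X) (ψ : Y ⟶ Z)
    (hφ : ∀ x : var F X, (mor F φ ⁻¹' {x}).Finite) {z : var F Z} (hz : IsClosed {z})
    (W : Subvariety F X)
    (hW : (weaklySpecialHull W : Set (var F X)) ⊆ mor F φ '' (mor F ψ ⁻¹' {z})) :
    dim (specialHull (pointClosure z)) + dim (weaklySpecialHull W) ≤ dim (specialHull W) := by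
  obtain ⟨y, hy, hyg⟩ := hW (gen_mem _)
  obtain ⟨Q, σ, hσ⟩ := (isLeast_specialHull W).1.1
  obtain ⟨q, hq⟩ := hσ.subset (weaklySpecialHull_le_specialHull W (gen_mem _))
  obtain ⟨_, D, a, b, hab, h⟩ := exists_inter_eq_iUnion (F := F) φ σ
  obtain ⟨i, t, rfl, -⟩ := h y q (hyg.trans hq.symm)
  obtain ⟨c, hc, hc'⟩ := exists_fiber_tdeg (F := F) (a i)
  obtain ⟨n, hn, hn'⟩ := exists_fiber_tdeg (F := F) (a i ≫ ψ)
  have hy' : mor F ψ (mor F (a i) t) = z := hy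
  obtain ⟨t', -, ht', ht'd⟩ := hc' t
  have h1 := hn t'
  rw [mor_comp_apply, ht', hy', tdeg_eq_zero hz] at h1
  obtain ⟨η, hη, -, h2⟩ := hn' (eta F (D i))
  -- A generic point has no proper generalization, so the point attaining the fiber dimension is the
  -- generic point itself.
  obtain rfl : η = eta F (D i) := (hη.antisymm (eta_specializes η)).eq
  have h3 := hc (eta F (D i))
  have h4 : dim (specialHull (pointClosure z)) ≤ tdeg (mor F (a i ≫ ψ) (eta F (D i))) := by
    rw [← dim_pointClosure]
    refine dim_mono (specialHull_le (isSpecial_pointClosure_eta _) ?_)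
    rw [pointClosure_le_iff, coe_pointClosure_eta]
    exact ⟨t, (mor_comp_apply F _ _ t).trans hy'⟩
  have h5 : dim (weaklySpecialHull W) = tdeg (mor F (a i) t) := by
    rw [dim_eq, ← hyg, tdeg_mor_eq φ (hφ _)]
  have h6 : tdeg (mor F (a i) (eta F (D i))) ≤ dim (specialHull W) := by
    rw [← tdeg_mor_eq φ (hφ _), hab]
    exact tdeg_le_dim (hσ.superset ⟨_, rfl⟩)
  omega

/-- The generic point of the component lifts to the fiber of ψ; generalizing the lift within this
fiber until it has the full relative dimension cannot enlarge the component, by maximality, and φ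
preserves dimensions. -/
lemma dim_eq_of_isComponentOf {X Y Z : C} (φ : Y ⟶ X) (ψ : Y ⟶ Z)
    (hφ : ∀ x : var F X, (mor F φ ⁻¹' {x}).Finite) {z : var F Z} (hz : IsClosed {z}) {n : ℕ}
    (hn : ∀ y : var F Y, ∃ y', y' ⤳ y ∧ mor F ψ y' = mor F ψ y ∧
      tdeg y' = tdeg (mor F ψ y) + n) {B : Subvariety F X}
    (hB : IsComponentOf (B : Set (var F X)) (mor F φ '' (mor F ψ ⁻¹' {z}))) : dim B = n := by
  obtain ⟨y, hy, hyB⟩ := hB.prop.2 (gen_mem B)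
  obtain ⟨y', hyy, hy', hd⟩ := hn y
  rw [show mor F ψ y = z from hy] at hy' hd
  have hle : B ≤ pointClosure (mor F φ y') := by
    rw [← pointClosure_gen B, pointClosure_le_pointClosure, ← hyB]
    exact hyy.map (mor F φ).continuous
  have hsub : (pointClosure (mor F φ y') : Set (var F X)) ⊆ mor F φ '' (mor F ψ ⁻¹' {z}) :=
    (isClosed_image_fiber φ ψ z hz).closure_subset_iff.2
      (Set.singleton_subset_iff.2 ⟨y', hy', rfl⟩)
  have heq : B = pointClosure (mor F φ y') :=
    hle.antisymm (hB.le_of_ge ⟨(pointClosure (mor F φ y')).isIrreducible, hsub⟩ hle)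
  rw [heq, dim_pointClosure, tdeg_mor_eq φ (hφ _), hd, tdeg_eq_zero hz, zero_add]

lemma dim_weaklySpecialHull_le {X Y Z : C} (φ : Y ⟶ X) (ψ : Y ⟶ Z)
    (hφ : ∀ x : var F X, (mor F φ ⁻¹' {x}).Finite) {n : ℕ}
    (hn : ∀ y : var F Y, ∃ y', y' ⤳ y ∧ mor F ψ y' = mor F ψ y ∧
      tdeg y' = tdeg (mor F ψ y) + n) (y : var F Y) (hz : IsClosed {mor F ψ y}) :
    dim (weaklySpecialHull (pointClosure (mor F φ y))) ≤ n := by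
  have hcl := isClosed_image_fiber φ ψ _ hz
  have hsub : (pointClosure (mor F φ y) : Set (var F X)) ⊆
      mor F φ '' (mor F ψ ⁻¹' {mor F ψ y}) :=
    hcl.closure_subset_iff.2 (Set.singleton_subset_iff.2 ⟨y, rfl, rfl⟩)
  obtain ⟨B, hB, hle⟩ := exists_isComponentOf (pointClosure (mor F φ y)).isIrreducible hsub
  have hd := dim_eq_of_isComponentOf φ ψ hφ hz hn (B := ⟨B, hB.prop.1, hB.isClosed hcl⟩) hB
  rw [← hd]
  exact dim_mono (weaklySpecialHull_le ⟨Y, Z, φ, ψ, _, hz, hB⟩ hle)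

/-- The defect condition. -/
theorem dim_specialHull_add_le (hfin : WeakFiniteness F) {X : C} {V W : Subvariety F X}
    (h : W ≤ V) : dim (specialHull V) + dim (weaklySpecialHull W) ≤
      dim (specialHull W) + dim (weaklySpecialHull V) := by
  obtain ⟨T, -, hT⟩ := hfin X V
  -- `V` is vacuously weakly optimal for itself, so its own weakly special hull comes from a pair
  -- with φ of finite fibers. The two hull inequalities for this pair and the same `z` are then
  -- added.
  obtain ⟨p, -, z, hz, hφ, hcomp⟩ := hT V ⟨le_rfl, fun U h h' => absurd h h'.not_gt⟩
  obtain ⟨n, hn, hn'⟩ := exists_fiber_tdeg (F := F) p.ψ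
  obtain ⟨y, hy, hyg⟩ := hcomp.prop.2 (le_weaklySpecialHull V (gen_mem V))
  have h1 := dim_specialHull_le p.φ p.ψ hn (pointClosure z) y
    (by rw [show mor F p.ψ y = z from hy]; exact subset_closure rfl)
  rw [hyg, pointClosure_gen] at h1
  have h2 := dim_eq_of_isComponentOf p.φ p.ψ hφ hz hn' hcomp
  have h3 := dim_specialHull_add_dim_weaklySpecialHull_le p.φ p.ψ hφ hz W
    (subset_trans (weaklySpecialHull_mono h) hcomp.prop.2)
  omega

/-- By the defect condition, δ_ws grows from W to U at least as much as δ does. -/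
theorem IsOptimal.isWeaklyOptimal (hfin : WeakFiniteness F) {X : C} {V W : Subvariety F X}
    (h : IsOptimal V W) : IsWeaklyOptimal V W := by
  refine ⟨h.1, fun U hWU hUV => ?_⟩
  have h1 := h.2 U hWU hUV
  have h2 := dim_specialHull_add_le hfin hWU.le
  simp only [defect, weakDefect] at h1 ⊢
  omega

end Hulls

/-! ### Finiteness of optimal subvarieties -/

section Main

variable {K : Type u} [Field K] [IsAlgClosed K] {C : Type v} [Category.{w} C] {F : C ⥤ Variety K}
  [IsDistinguished F] {X : C}

/-- The point `y` of `Y_φ` lifts the generic point of a subvariety `W` which is optimal for `V`, has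
defect at most `d`, and whose weakly special hull is given by the fiber of `ψ` through `y`. -/
structure IsOptimalLift (V : Subvariety F X) (d : ℕ) (p : MorphismPair X) (y : var F p.Y)
    (W : Subvariety F X) : Prop where
  isOptimal : IsOptimal V W
  defect_le : defect W ≤ d
  isClosed : IsClosed {mor F p.ψ y}
  map_eq : mor F p.φ y = gen W
  isComponentOf : IsComponentOf (weaklySpecialHull W : Set (var F X))
    (mor F p.φ '' (mor F p.ψ ⁻¹' {mor F p.ψ y}))

variable {V W : Subvariety F X} {d : ℕ} {p : MorphismPair X} {y : var F p.Y}

lemma IsOptimalLift.tdeg_eq (h : IsOptimalLift V d p y W)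
    (hφ : ∀ x : var F X, (mor F p.φ ⁻¹' {x}).Finite) : tdeg y = dim W := by
  rw [dim_eq, ← h.map_eq, tdeg_mor_eq _ (hφ _)]

lemma IsOptimalLift.pointClosure_map_eq (h : IsOptimalLift V d p y W) :
    pointClosure (mor F p.φ y) = W := by
  rw [h.map_eq, pointClosure_gen]

/-- With z = ψ(y): dim ⟨z⟩ ≤ dim ⟨W⟩ - dim ⟨W⟩_ws ≤ δ(W). -/
lemma IsOptimalLift.defect_pointClosure_le (h : IsOptimalLift V d p y W)
    (hφ : ∀ x : var F X, (mor F p.φ ⁻¹' {x}).Finite) :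
    defect (pointClosure (mor F p.ψ y)) ≤ d := by
  obtain ⟨n, hn, hn'⟩ := exists_fiber_tdeg (F := F) p.ψ
  have h1 := dim_specialHull_add_dim_weaklySpecialHull_le p.φ p.ψ hφ h.isClosed W
    h.isComponentOf.prop.2
  have h2 := dim_mono (le_weaklySpecialHull W)
  have h3 := h.defect_le
  simp only [defect, dim_pointClosure, tdeg_eq_zero h.isClosed] at h3 ⊢
  omega

/-- Near the generic point of `E`, the image under `ψ` of a lift of an optimal subvariety is optimal
for the closure of the image of `E`. -/
lemma exists_isOpen_forall_isOptimal (hφ : ∀ x : var F X, (mor F p.φ ⁻¹' {x}).Finite)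
    (E : Subvariety F p.Y) (hE : ∀ y ∈ (E : Set (var F p.Y)), mor F p.φ y ∈ (V : Set (var F X))) :
    ∃ O : Set (var F p.Y), IsOpen O ∧ gen E ∈ O ∧ ∀ y ∈ O, y ∈ (E : Set (var F p.Y)) →
      ∀ W, IsOptimalLift V d p y W →
        IsOptimal (pointClosure (mor F p.ψ (gen E))) (pointClosure (mor F p.ψ y)) := by
  obtain ⟨O, hO, hEO, hmain⟩ := exists_isOpen_forall_tdeg_add_le p.ψ (gen E)
  refine ⟨O, hO, hEO, fun y hyO hyE W hW => ⟨?_, fun U hzU hUV => ?_⟩⟩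
  · rw [pointClosure_le_pointClosure]
    exact (gen_specializes_iff.2 hyE).map (mor F p.ψ).continuous
  obtain ⟨n, hn, hn'⟩ := exists_fiber_tdeg (F := F) p.ψ
  have hU : gen U ⤳ mor F p.ψ y := gen_specializes_iff.2 (pointClosure_le_iff.1 hzU.le)
  -- The lift `u` of the generic point of `U` satisfies dim U + dim W ≤ `tdeg u`. With n = dim
  -- ⟨W⟩_ws, the final count is dim ⟨z⟩ + n - dim W ≤ δ(W) < δ(φ(u)) ≤ dim ⟨U⟩ + n - dim W - dim U.
  obtain ⟨u, hEu, huy, hu, hdim⟩ := hmain y hyO (gen_specializes_iff.2 hyE) (gen U)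
    (mem_pointClosure.1 (hUV (gen_mem U))) hU
  rw [tdeg_eq_zero hW.isClosed, ← dim_eq, hW.tdeg_eq hφ] at hdim
  have hpos := dim_strictMono hzU
  have hdu : dim (pointClosure (mor F p.φ u)) = tdeg u := by
    rw [dim_pointClosure, tdeg_mor_eq _ (hφ _)]
  have hWu : W ≤ pointClosure (mor F p.φ u) := by
    rw [← hW.pointClosure_map_eq, pointClosure_le_pointClosure]
    exact huy.map (mor F p.φ).continuous
  have hlt : W < pointClosure (mor F p.φ u) := lt_of_le_of_ne hWu fun heq => by
    rw [← heq] at hdu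
    omega
  have h1 := hW.isOptimal.2 _ hlt
    (pointClosure_le_iff.2 (hE u (gen_specializes_iff.1 hEu)))
  have h2 := dim_specialHull_le p.φ p.ψ hn U u (hu ▸ gen_mem U)
  have h3 := dim_specialHull_add_dim_weaklySpecialHull_le p.φ p.ψ hφ hW.isClosed W
    hW.isComponentOf.prop.2
  have h4 := dim_eq_of_isComponentOf p.φ p.ψ hφ hW.isClosed hn' hW.isComponentOf
  simp only [defect, dim_pointClosure, tdeg_eq_zero hW.isClosed] at h1 ⊢
  rw [dim_pointClosure] at hdu
  omega

/-- Only finitely many optimal subvarieties lift to points of a given fiber of `ψ`. -/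
lemma finite_isOptimalLift_fiber (hfin : WeakFiniteness F)
    (hφ : ∀ x : var F X, (mor F p.φ ⁻¹' {x}).Finite) (E : Subvariety F p.Y)
    (hE : ∀ y ∈ (E : Set (var F p.Y)), mor F p.φ y ∈ (V : Set (var F X))) (z : var F p.Z)
    (hz : IsClosed {z}) :
    {W | ∃ y ∈ (E : Set (var F p.Y)), mor F p.ψ y = z ∧ IsOptimalLift V d p y W}.Finite := by
  obtain ⟨A, hA, hAcl, hAirr, hAE⟩ := NoetherianSpace.exists_finite_set_isClosed_irreducible
    (E.isClosed.inter (hz.preimage (mor F p.ψ).continuous))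
  obtain ⟨n, hn, hn'⟩ := exists_fiber_tdeg (F := F) p.ψ
  have := hA.to_subtype
  refine (Set.finite_range fun B : A => pointClosure
    (mor F p.φ (gen (⟨B, hAirr _ B.2, hAcl _ B.2⟩ : Subvariety F p.Y)))).subset ?_
  rintro W ⟨y, hyE, hyz, hW⟩
  obtain ⟨B, hB, hyB⟩ := hAE.subset ⟨hyE, hyz⟩
  let B' : Subvariety F p.Y := ⟨B, hAirr _ hB, hAcl _ hB⟩
  refine ⟨⟨B, hB⟩, ?_⟩
  change pointClosure (mor F p.φ (gen B')) = W
  have hsp : gen B' ⤳ y := gen_specializes_iff.2 hyB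
  obtain ⟨hgE, hgz⟩ := hAE.superset ⟨B, hB, gen_mem B'⟩
  have hgz' : mor F p.ψ (gen B') = z := hgz
  have hle : W ≤ pointClosure (mor F p.φ (gen B')) := by
    rw [← hW.pointClosure_map_eq, pointClosure_le_pointClosure]
    exact hsp.map (mor F p.φ).continuous
  -- A strictly larger closure would have a weakly special hull of dimension at most n = dim ⟨W⟩_ws,
  -- hence a smaller weak defect than W, against weak optimality.
  by_contra hne
  have h1 := (hW.isOptimal.isWeaklyOptimal hfin).2 _ (lt_of_le_of_ne hle (Ne.symm hne))
    (pointClosure_le_iff.2 (hE _ hgE))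
  have h2 := dim_weaklySpecialHull_le p.φ p.ψ hφ hn' (gen B') (by rwa [hgz'])
  have h3 := dim_eq_of_isComponentOf p.φ p.ψ hφ hW.isClosed hn' hW.isComponentOf
  have h4 := dim_strictMono (lt_of_le_of_ne hle (Ne.symm hne))
  simp only [weakDefect] at h1
  omega

/-- Finiteness of the optimal subvarieties which lift to a given subvariety, by Noetherian
induction. -/
theorem finite_isOptimalLift (hfin : WeakFiniteness F) {m : ℕ} (hV : dim V ≤ m)
    (hsing : ∀ V' : Subvariety F p.Z, dim V' ≤ m →
      {W : Subvariety F p.Z | IsOptimal V' W ∧ (∃ x : var F p.Z, (W : Set (var F p.Z)) = {x}) ∧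
        defect W ≤ d}.Finite)
    (hφ : ∀ x : var F X, (mor F p.φ ⁻¹' {x}).Finite) (E : Subvariety F p.Y)
    (hE : ∀ y ∈ (E : Set (var F p.Y)), mor F p.φ y ∈ (V : Set (var F X))) :
    {W | ∃ y ∈ (E : Set (var F p.Y)), IsOptimalLift V d p y W}.Finite := by
  have hmono : StrictMono (fun E : Subvariety F p.Y => dim E) := fun _ _ h => dim_strictMono h
  have : WellFoundedLT (Subvariety F p.Y) := hmono.wellFoundedLT
  induction E using WellFoundedLT.induction with
  | _ E ih =>
    obtain ⟨O, hO, hEO, hmain⟩ := exists_isOpen_forall_isOptimal (d := d) hφ E hE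
    obtain ⟨A, hA, hAcl, hAirr, hAE⟩ := NoetherianSpace.exists_finite_set_isClosed_irreducible
      (E.isClosed.inter hO.isClosed_compl)
    -- Finite fibers of φ bound dim E by dim V, so the bound `m` survives the passage to `p.Z`.
    have hdim : dim (pointClosure (mor F p.ψ (gen E))) ≤ m := by
      rw [dim_pointClosure]
      refine (tdeg_mor_le _ _).trans (le_trans ?_ hV)
      rw [← tdeg_mor_eq p.φ (hφ _)]
      exact tdeg_le_dim (hE _ (gen_mem E))
    let P : Set (var F p.Z) := {z | IsClosed {z} ∧
      IsOptimal (pointClosure (mor F p.ψ (gen E))) (pointClosure z) ∧ defect (pointClosure z) ≤ d}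
    have hP : P.Finite := by
      refine ((hsing _ hdim).preimage (f := pointClosure) ?_).subset ?_
      · exact (Function.LeftInverse.injective gen_pointClosure).injOn
      · rintro z ⟨hz, hopt, hd⟩
        exact ⟨hopt, ⟨z, hz.closure_eq⟩, hd⟩
    have hB : ∀ B : A, {W | ∃ y ∈ (B : Set (var F p.Y)), IsOptimalLift V d p y W}.Finite := by
      intro B
      have hsub : (B : Set (var F p.Y)) ⊆ E ∩ Oᶜ := by
        rw [hAE]
        exact Set.subset_sUnion_of_mem B.2
      let B' : Subvariety F p.Y := ⟨B, hAirr _ B.2, hAcl _ B.2⟩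
      refine ih B' (lt_of_le_of_ne (fun y hy => (hsub hy).1) fun heq => ?_)
        fun y hy => hE y (hsub hy).1
      exact (hsub (heq.symm.le (gen_mem E) : gen E ∈ (B' : Set (var F p.Y)))).2 hEO
    have := hA.to_subtype
    refine ((hP.biUnion fun z hz => finite_isOptimalLift_fiber (d := d) hfin hφ E hE z hz.1).union
      (Set.finite_iUnion hB)).subset ?_
    rintro W ⟨y, hyE, hW⟩
    by_cases hyO : y ∈ O
    · exact Or.inl (Set.mem_biUnion (x := mor F p.ψ y)
        ⟨hW.isClosed, hmain y hyO hyE W hW, hW.defect_pointClosure_le hφ⟩ ⟨y, hyE, rfl, hW⟩)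
    · obtain ⟨B, hB, hyB⟩ := hAE.subset ⟨hyE, hyO⟩
      exact Or.inr (Set.mem_iUnion.2 ⟨⟨B, hB⟩, y, hyB, hW⟩)

end Main

end ZilberPink

theorem mainTheorem6 {K : Type u} [Field K] [IsAlgClosed K] [CharZero K]
    {C : Type v} [Category.{w} C] (F : C ⥤ Variety K) [IsDistinguished F]
    (hfin : WeakFiniteness F) (m d : ℕ) (X : C) (S : Set C) (hX : X ∈ S)
    (hS : ∀ X' ∈ S, ∀ V : Subvariety F X', ∃ T : Set (MorphismPair X'),
      IsWeakFinitenessSet V T ∧ ∀ p ∈ T, p.Y ∈ S ∧ p.Z ∈ S)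
    (hsing : ∀ X' ∈ S, ∀ V : Subvariety F X', dim V ≤ m →
      {W : Subvariety F X' | IsOptimal V W ∧ (∃ x : var F X', (W : Set (var F X')) = {x}) ∧
        defect W ≤ d}.Finite) :
    ZP F X m d := by
  intro V hV
  obtain ⟨T, ⟨hT, hTV⟩, hTS⟩ := hS X hX V
  have key : ∀ p ∈ T, {W : Subvariety F X |
      (∀ x : var F X, (mor F p.φ ⁻¹' {x}).Finite) ∧
        ∃ y, mor F p.φ y ∈ (V : Set (var F X)) ∧ IsOptimalLift V d p y W}.Finite := by
    intro p hp
    by_cases hφ : ∀ x : var F X, (mor F p.φ ⁻¹' {x}).Finite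
    · obtain ⟨A, hA, hAcl, hAirr, hAE⟩ := NoetherianSpace.exists_finite_set_isClosed_irreducible
        (V.isClosed.preimage (mor F p.φ).continuous)
      have := hA.to_subtype
      refine (Set.finite_iUnion fun B : A => finite_isOptimalLift (d := d) hfin hV
        (hsing p.Z (hTS p hp).2) hφ ⟨B, hAirr _ B.2, hAcl _ B.2⟩ fun y hy => ?_).subset ?_
      · exact hAE.superset ⟨B, B.2, hy⟩
      · rintro W ⟨-, y, hyV, hW⟩
        obtain ⟨B, hB, hyB⟩ := hAE.subset hyV
        exact Set.mem_iUnion.2 ⟨⟨B, hB⟩, y, hyB, hW⟩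
    -- The weak finiteness set may contain pairs whose φ has infinite fibers; no `W` is attributed
    -- to them.
    · exact Set.finite_empty.subset fun W hW => hφ hW.1
  refine (hT.biUnion key).subset ?_
  rintro W ⟨hopt, hd⟩
  obtain ⟨p, hp, z, hz, hφ, hcomp⟩ := hTV W (hopt.isWeaklyOptimal hfin)
  -- The point lifted is the generic point of `W`, not that of its hull, so that `y` lies over `V`.
  obtain ⟨y, rfl, hyW⟩ := hcomp.prop.2 (le_weaklySpecialHull W (gen_mem W))
  refine Set.mem_biUnion hp ⟨hφ, y, ?_, hopt, hd, hz, hyW, hcomp⟩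
  rw [hyW]
  exact hopt.1 (gen_mem W)
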